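/- For graphs $G_1,G_2$ let $R(G_1,G_2)$ be the least integer $r$ such that for every simple graph $G$ on $r$ vertices, $G$ contains $G_1$ or the complement $\overline{G}$ contains $G_2$ as a (not necessarily induced) subgraph. Let $P_n$ be the path on $n$ vertices, and let $K_1\vee mK_2$ be the fan obtained by joining one vertex to every vertex of $m$ disjoint edges (so it has $2m+1$ vertices). For integers $n,k\ge 2$ put $$\alpha=\frac{k-1}{n-1},\qquad \beta=\lceil\alpha\rceil,\qquad \gamma=\frac{\beta^2}{\beta+1},\qquad t(n,k)=\begin{cases}(n-1)\beta+1, & \alpha\le\gamma,\\ \lfloor (k-1)/\beta\rfloor+k, & \alpha>\gamma.\end{cases}$$ Then $$R(P_n,K_1\vee mK_2)=\begin{cases}2n-1, & 1\le m\le\lfloor n/2\rfloor,\\ 2m+n-2, & \lfloor n/2\rfloor+1\le m\le n-1,\\ t(n,2m), & n\ge 2\text{ and } m\ge n.\end{cases}$$ -/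

import Mathlib

/-- The join `G ∨ H`: the disjoint union of `G` and `H` together with every edge between them. -/
def graphJoin {V W : Type*} (G : SimpleGraph V) (H : SimpleGraph W) : SimpleGraph (V ⊕ W) where
  Adj x y := match x, y with
    | Sum.inl u, Sum.inl v => G.Adj u v
    | Sum.inr u, Sum.inr v => H.Adj u v
    | Sum.inl _, Sum.inr _ => True
    | Sum.inr _, Sum.inl _ => True
  symm := ⟨by
    rintro (u | u) (v | v) h
    · exact G.adj_symm h
    · trivial
    · trivial
    · exact H.adj_symm h⟩
  loopless := ⟨by
    rintro (u | u) h
    · exact G.irrefl h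
    · exact H.irrefl h⟩

/-- `mG`: the disjoint union of `m` copies of `G`; the vertex `(i, v)` is `v` in the `i`-th copy. -/
def graphCopies {V : Type*} (m : ℕ) (G : SimpleGraph V) : SimpleGraph (Fin m × V) where
  Adj x y := x.1 = y.1 ∧ G.Adj x.2 y.2
  symm := ⟨fun _ _ h => ⟨h.1.symm, G.adj_symm h.2⟩⟩
  loopless := ⟨fun _ h => G.irrefl h.2⟩

/-- The fan `K₁ ∨ mK₂` on `2m + 1` vertices. -/
def fanGraph (m : ℕ) : SimpleGraph (Fin 1 ⊕ (Fin m × Fin 2)) :=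
  graphJoin (⊤ : SimpleGraph (Fin 1)) (graphCopies m (⊤ : SimpleGraph (Fin 2)))

/-- `IsRamseyNumber G₁ G₂ r`: `r` is the least natural number such that every graph `G` on `r`
vertices contains `G₁` or its complement contains `G₂` (as a not necessarily induced subgraph). -/
def IsRamseyNumber {V W : Type*} (G₁ : SimpleGraph V) (G₂ : SimpleGraph W) (r : ℕ) : Prop :=
  IsLeast {r : ℕ | ∀ G : SimpleGraph (Fin r), G₁.IsContained G ∨ G₂.IsContained Gᶜ} r

/-- `α = (m - 1) / (n - 1)`, a rational number (meant for `n, m ≥ 2`). -/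
def tAlpha (n m : ℕ) : ℚ := ((m : ℚ) - 1) / ((n : ℚ) - 1)

/-- `β = ⌈α⌉`. -/
def tBeta (n m : ℕ) : ℕ := ⌈tAlpha n m⌉₊

/-- `γ = β² / (β + 1)`. -/
def tGamma (n m : ℕ) : ℚ := (tBeta n m : ℚ) ^ 2 / ((tBeta n m : ℚ) + 1)

/-- `t(n, m)` for `n, m ≥ 2`: it is `(n - 1) β + 1` if `α ≤ γ`, and `⌊(m - 1) / β⌋ + m` if
`α > γ`. -/
def tValue (n m : ℕ) : ℕ :=
  if tAlpha n m ≤ tGamma n m then (n - 1) * tBeta n m + 1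
  else ⌊((m : ℚ) - 1) / (tBeta n m : ℚ)⌋₊ + m

open Finset

/-! Upper bound: suppose `G` has no path on `n` vertices and its complement has no fan. The
non-neighbours of a vertex `v` then carry no `m` disjoint non-edges. If there are at least `2m` of
them, Tutte–Berge (`exists_matching_or_multipartite`) gives a set `T` whose removal splits them into
many classes, with all edges of `G` between distinct classes. Were all components smaller than `n`,
this could be applied to everything outside a smallest component, and the multipartite remainder
would be connected but too large for any component (`exists_large_component`). So some component `C`
has at least `n` vertices.

Let `s = ⌊n/2⌋ - 1`. If all degrees in `C` exceed `s`, Dirac's argument gives the path. Otherwise a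
vertex of degree at most `s` has a set `D` of at most `s` non-neighbours that dominates almost all
its other non-neighbours (`exists_dominating_set`). For `m < n` the counts are tight, and a path
alternating between `D` and the rest suffices. For `m ≥ n` such sets accumulate in a maximal linked
set `Z`. Either `Z` outgrows `s` vertices and an alternating path is long enough, or every vertex of
`C` has more than `s - |Z|` neighbours outside `Z`. In that case two arms outside `Z`
(`exists_two_arms`), joined through `Z`, have `2s + 3 ≥ n` vertices; Dirac's argument covers empty
`Z`.

Lower bound: disjoint unions of cliques of order at most `n - 1`, namely orders `n-1, n-1`, orders
`n-1, m-1, m-1`, or nearly equal orders. `tValue_spec` shows that the last example meets the upper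
bound. -/

/-- `l` lists the vertices of a path of `G` in order. -/
def IsPathList {V : Type*} (G : SimpleGraph V) (l : List V) : Prop :=
  l.IsChain G.Adj ∧ l.Nodup

/-! ### Paths as lists, and Dirac's theorem on long paths. -/

section PathList

variable {V : Type*} {G : SimpleGraph V}

theorem IsPathList.reverse {l : List V} (h : IsPathList G l) : IsPathList G l.reverse := by
  refine ⟨?_, List.nodup_reverse.2 h.2⟩
  rw [List.isChain_reverse]
  exact h.1.imp fun _ _ hab => hab.symm

theorem IsPathList.append {l₁ l₂ : List V} (h₁ : IsPathList G l₁) (h₂ : IsPathList G l₂)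
    (hd : ∀ x ∈ l₁, x ∉ l₂) (hadj : ∀ x ∈ l₁.getLast?, ∀ y ∈ l₂.head?, G.Adj x y) :
    IsPathList G (l₁ ++ l₂) :=
  ⟨h₁.1.append h₂.1 hadj, List.nodup_append'.2 ⟨h₁.2, h₂.2, fun x hx hx' => hd x hx hx'⟩⟩

theorem IsPathList.cons {x : V} {l : List V} (h : IsPathList G l) (hx : x ∉ l)
    (hadj : ∀ y ∈ l.head?, G.Adj x y) : IsPathList G (x :: l) :=
  ⟨h.1.cons hadj, List.nodup_cons.2 ⟨hx, h.2⟩⟩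

theorem isPathList_singleton (x : V) : IsPathList G [x] :=
  ⟨List.isChain_singleton _, List.nodup_singleton _⟩

theorem IsPathList.take {l : List V} (h : IsPathList G l) (i : ℕ) : IsPathList G (l.take i) :=
  ⟨h.1.take i, h.2.sublist (List.take_sublist _ _)⟩

theorem IsPathList.drop {l : List V} (h : IsPathList G l) (i : ℕ) : IsPathList G (l.drop i) :=
  ⟨h.1.drop i, h.2.sublist (List.drop_sublist _ _)⟩

theorem IsPathList.length_lt_of_not_isContained {n : ℕ}
    (hG : ¬ (SimpleGraph.pathGraph n).IsContained G) {l : List V} (h : IsPathList G l) :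
    l.length < n := by
  by_contra! hn
  apply hG
  have hc := List.isChain_iff_getElem.1 h.1
  refine ⟨⟨⟨fun i => l[i.1], ?_⟩, ?_⟩⟩
  · intro a b hab
    rw [SimpleGraph.pathGraph_adj] at hab
    rcases hab with hab | hab
    · have := hc a.1 (by have := b.2; omega)
      simpa [hab] using this
    · have := hc b.1 (by have := a.2; omega)
      simpa [hab] using this.symm
  · intro a b hab
    have := (h.2.getElem_inj_iff (hi := by have := a.2; omega) (hj := by have := b.2; omega)).1 hab
    exact Fin.ext this

theorem exists_longest [Fintype V] {P : List V → Prop} (hne : ∃ l, P l) (hP : ∀ l, P l → l.Nodup) :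
    ∃ l, P l ∧ ∀ l', P l' → l'.length ≤ l.length := by
  classical
  have hb : ∀ k, (∃ l, P l ∧ l.length = k) → k ≤ Fintype.card V := by
    rintro k ⟨l, hl, rfl⟩
    exact (hP l hl).length_le_card
  obtain ⟨l₀, hl₀⟩ := hne
  have hs := Nat.findGreatest_spec (P := fun k => ∃ l, P l ∧ l.length = k)
    (hb _ ⟨l₀, hl₀, rfl⟩) ⟨l₀, hl₀, rfl⟩
  obtain ⟨l, hl, hlen⟩ := hs
  refine ⟨l, hl, fun l' hl' => ?_⟩
  rw [hlen]
  exact Nat.le_findGreatest (hb _ ⟨l', hl', rfl⟩) ⟨l', hl', rfl⟩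

/-- Opening a cycle at a vertex with a neighbour `y` outside gives a path with one more vertex. -/
theorem exists_isPathList_of_cycle {l : List V} (h : IsPathList G l)
    (hclose : ∀ x ∈ l.getLast?, ∀ y ∈ l.head?, G.Adj x y) {x y : V} (hx : x ∈ l) (hy : y ∉ l)
    (hxy : G.Adj y x) :
    ∃ l', IsPathList G l' ∧ l'.length = l.length + 1 ∧ ∀ z ∈ l', z = y ∨ z ∈ l := by
  obtain ⟨a, b, rfl⟩ := List.append_of_mem hx
  have hab : IsPathList G a := by simpa using h.take a.length
  have hb : IsPathList G (x :: b) := by simpa using h.drop a.length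
  have hn := List.nodup_append'.1 h.2
  refine ⟨y :: ((x :: b) ++ a), ?_, by simp; omega, ?_⟩
  · refine IsPathList.cons (hb.append hab (fun z hz hz' => hn.2.2 hz' hz) ?_) ?_ ?_
    · intro u hu v hv
      refine hclose u ?_ v ?_
      · rw [List.getLast?_append]; simp only [Option.mem_def] at hu ⊢; rw [hu]; rfl
      · rw [List.head?_append]; simp only [Option.mem_def] at hv ⊢; rw [hv]; rfl
    · simp only [List.mem_append, List.mem_cons, not_or] at hy ⊢
      tauto
    · intro z hz
      simp at hz
      exact hz ▸ hxy
  · intro z hz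
    simp only [List.mem_append, List.mem_cons] at hz ⊢
    tauto

/-- Dirac's theorem on long paths, for an induced subgraph. -/
theorem exists_long_path_of_degree [Fintype V] [DecidableEq V] [DecidableRel G.Adj]
    {s n : ℕ} (hn : n ≤ 2 * s + 3) {X : Finset V} (hX : n ≤ X.card) (h0 : 0 < n)
    (hconn : ∀ Y ⊆ X, Y.Nonempty → (∀ y ∈ Y, ∀ x ∈ X, G.Adj y x → x ∈ Y) → X ⊆ Y)
    (hdeg : ∀ x ∈ X, s + 1 ≤ {y ∈ X | G.Adj x y}.card) :
    ∃ l, IsPathList G l ∧ n ≤ l.length := by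
  obtain ⟨x₀, hx₀⟩ : X.Nonempty := card_pos.1 (by omega)
  obtain ⟨l, ⟨hl, hlX⟩, hmax⟩ := exists_longest (P := fun l => IsPathList G l ∧ ∀ x ∈ l, x ∈ X)
    ⟨[x₀], isPathList_singleton _, by simpa⟩ (fun l h => h.1.2)
  refine ⟨l, hl, ?_⟩
  by_contra! hlt
  have hp1 : 1 ≤ l.length := hmax [x₀] ⟨isPathList_singleton _, by simpa⟩
  set p := l.length with hp
  have hends : ∀ l', IsPathList G l' → (∀ x, x ∈ l' ↔ x ∈ l) → l'.length = p →
      ∀ x ∈ l'.head?, ∀ y ∈ X, G.Adj x y → y ∈ l := by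
    intro l' hl' hmem hlen x hx y hy hxy
    by_contra hyl
    have := hmax (y :: l') ⟨hl'.cons (by rwa [hmem]) ?_, ?_⟩
    · simp at this; omega
    · intro z hz
      cases Option.mem_unique hx hz
      exact hxy.symm
    · intro z hz
      rcases List.mem_cons.1 hz with rfl | hz
      · exact hy
      · exact hlX z ((hmem z).1 hz)
  have hu : ∀ y ∈ X, G.Adj l[0] y → y ∈ l :=
    hends l hl (fun _ => Iff.rfl) rfl l[0] (by simp [List.head?_eq_getElem?])
  have hw : ∀ y ∈ X, G.Adj l[p - 1] y → y ∈ l :=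
    hends l.reverse hl.reverse (by simp) (by simp [hp]) l[p - 1]
      (by simp [List.getLast?_eq_getElem?, hp])
  -- The default `x₀` is never read: only positions below `p` are used.
  let f : ℕ → V := fun i => l.getD i x₀
  have hf : ∀ i (hi : i < l.length), f i = l[i] := fun i hi => by simp [f, hi]
  let A := {i ∈ range (p - 1) | G.Adj l[0] (f (i + 1))}
  let B := {i ∈ range (p - 1) | G.Adj l[p - 1] (f i)}
  have hA : s + 1 ≤ A.card := by
    refine (hdeg l[0] (hlX _ (List.getElem_mem _))).trans ?_
    refine (card_le_card ?_).trans (card_image_le (s := A) (f := fun i => f (i + 1)))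
    intro y hy
    rw [mem_filter] at hy
    obtain ⟨i, hi, rfl⟩ := List.getElem_of_mem (hu y hy.1 hy.2)
    rcases i with _ | i
    · exact absurd hy.2 (G.irrefl)
    · refine mem_image.2 ⟨i, ?_, hf _ hi⟩
      simp only [A, mem_filter, mem_range]
      exact ⟨by omega, by rw [hf _ hi]; exact hy.2⟩
  have hB : s + 1 ≤ B.card := by
    refine (hdeg l[p - 1] (hlX _ (List.getElem_mem _))).trans ?_
    refine (card_le_card ?_).trans (card_image_le (s := B) (f := f))
    intro y hy
    rw [mem_filter] at hy
    obtain ⟨i, hi, rfl⟩ := List.getElem_of_mem (hw y hy.1 hy.2)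
    have hip : i ≠ p - 1 := by
      rintro rfl
      exact absurd hy.2 (G.irrefl)
    refine mem_image.2 ⟨i, ?_, hf _ hi⟩
    simp only [B, mem_filter, mem_range]
    exact ⟨by omega, by rw [hf _ hi]; exact hy.2⟩
  -- `|A| + |B| ≥ 2s + 2`, but only `p - 1 ≤ 2s + 1` positions exist. A common `i` gives crossing
  -- chords from the two ends, which close the path into a cycle on the same vertices.
  obtain ⟨i, hi⟩ : (A ∩ B).Nonempty := by
    have h1 := card_union_add_card_inter A B
    have h2 : (A ∪ B).card ≤ p - 1 := by
      rw [← card_range (p - 1)]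
      exact card_le_card (union_subset (filter_subset _ _) (filter_subset _ _))
    exact card_pos.1 (by omega)
  simp only [A, B, mem_inter, mem_filter, mem_range] at hi
  obtain ⟨⟨hip, hi1⟩, -, hi2⟩ := hi
  rw [hf _ (by omega)] at hi1 hi2
  set c := l.take (i + 1) ++ (l.drop (i + 1)).reverse with hc
  have hcmem : ∀ x, x ∈ c ↔ x ∈ l := by
    intro x
    simp only [c, List.mem_append, List.mem_reverse]
    rw [← List.mem_append, List.take_append_drop]
  have hnd := hl.2
  rw [← List.take_append_drop (i + 1) l] at hnd
  have hdis := (List.nodup_append'.1 hnd).2.2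
  have hcp : IsPathList G c := by
    refine (hl.take _).append (hl.drop _).reverse (fun x hx hx' => hdis hx (by simpa using hx')) ?_
    intro x hx y hy
    rw [List.head?_reverse, List.getLast?_drop, if_neg (by omega), List.getLast?_eq_getElem?] at hy
    rw [List.getLast?_take, if_neg (by omega)] at hx
    have h1 : i < l.length := by omega
    have h2 : l.length - 1 < l.length := by omega
    simp [h1, h2] at hx hy
    subst hx hy
    exact hi2.symm
  have hcl : ∀ x ∈ c.getLast?, ∀ y ∈ c.head?, G.Adj x y := by
    intro x hx y hy
    have h1 : i + 1 < l.length := by omega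
    have h2 : 0 < l.length := by omega
    rw [hc, List.getLast?_append, List.getLast?_reverse, List.head?_drop] at hx
    rw [hc, List.head?_append, List.head?_take, if_neg (by omega), List.head?_eq_getElem?] at hy
    simp [h1, h2] at hx hy
    subst hx hy
    exact hi1.symm
  have hclen : c.length = p := by simp [c, hp]; omega
  have hnot : ¬ X ⊆ l.toFinset := fun h => by
    have := (card_le_card h).trans (List.toFinset_card_le l)
    omega
  apply hnot
  -- An edge leaving the cycle would open it into a longer path, so by connectivity the cycle would
  -- cover `X`.
  refine hconn l.toFinset (fun x hx => hlX x (by simpa using hx)) ⟨l[0], by simp⟩ ?_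
  intro y hy x hx hyx
  by_contra hxl
  rw [List.mem_toFinset] at hxl hy
  obtain ⟨l', hl', hlen', hmem'⟩ := exists_isPathList_of_cycle hcp hcl ((hcmem y).2 hy)
    (fun h => hxl ((hcmem x).1 h)) hyx.symm
  have := hmax l' ⟨hl', fun z hz => ?_⟩
  · omega
  · rcases hmem' z hz with rfl | h
    · exact hx
    · exact hlX z ((hcmem z).1 h)

end PathList

/-! ### Two disjoint arms, and joining them through a set with many common neighbours. -/

section Arms

variable {V : Type*} {G : SimpleGraph V}

/-- If every vertex of `H` has more than `e` neighbours in `H`, then `H` contains two disjoint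
paths on `2e + 4` vertices in total, both starting in a prescribed large set `U`. -/
theorem exists_two_arms [Fintype V] [DecidableEq V] [DecidableRel G.Adj] {e : ℕ} {H U : Finset V}
    (hUH : U ⊆ H) (hU : 2 * e + 4 ≤ U.card) (hdeg : ∀ x ∈ H, e + 1 ≤ {y ∈ H | G.Adj x y}.card) :
    ∃ A B : List V, IsPathList G A ∧ IsPathList G B ∧ (∀ x ∈ A, x ∉ B) ∧
      (∃ a ∈ U, a ∈ A.head?) ∧ (∃ b ∈ U, b ∈ B.head?) ∧ A.length + B.length = 2 * e + 4 ∧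
      (∀ x ∈ A, x ∈ H) ∧ (∀ x ∈ B, x ∈ H) := by
  obtain ⟨u₀, hu₀⟩ : U.Nonempty := card_pos.1 (by omega)
  obtain ⟨A, ⟨hA, hAH, a, haU, haA⟩, hAmax⟩ := exists_longest
    (P := fun l => IsPathList G l ∧ (∀ x ∈ l, x ∈ H) ∧ ∃ a ∈ U, a ∈ l.head?)
    ⟨[u₀], isPathList_singleton _, by simpa using hUH hu₀, u₀, hu₀, by simp⟩ (fun l h => h.1.2)
  have hfresh : ∀ l : List V, l.length ≤ 2 * e + 3 → ∃ b ∈ U, b ∉ l := by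
    intro l hl
    by_contra! hcon
    have : U ⊆ l.toFinset := fun x hx => by simpa using hcon x hx
    have := (card_le_card this).trans (List.toFinset_card_le l)
    omega
  -- If `A` is this long, a single vertex serves as the second arm.
  by_cases hlong : 2 * e + 3 ≤ A.length
  · obtain ⟨b, hbU, hb⟩ := hfresh (A.take (2 * e + 3)) (by simp)
    refine ⟨A.take (2 * e + 3), [b], hA.take _, isPathList_singleton _, ?_, ⟨a, haU, ?_⟩,
      ⟨b, hbU, by simp⟩, by simp; omega, fun x hx => hAH x (List.mem_of_mem_take hx), ?_⟩
    · intro x hx hxb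
      rw [List.mem_singleton] at hxb
      exact hb (hxb ▸ hx)
    · rw [List.head?_take, if_neg (by omega)]; exact haA
    · simpa using hUH hbU
  obtain ⟨u₁, hu₁U, hu₁A⟩ := hfresh A (by omega)
  obtain ⟨B, ⟨hB, hBH, hBA, b, hbU, hbB⟩, hBmax⟩ := exists_longest
    (P := fun l => IsPathList G l ∧ (∀ x ∈ l, x ∈ H) ∧ (∀ x ∈ l, x ∉ A) ∧ ∃ a ∈ U, a ∈ l.head?)
    ⟨[u₁], isPathList_singleton _, by simpa using hUH hu₁U, by simpa using hu₁A, u₁, hu₁U,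
      by simp⟩ (fun l h => h.1.2)
  have hBleA : B.length ≤ A.length := hAmax B ⟨hB, hBH, b, hbU, hbB⟩
  have hBpos : 0 < B.length := by
    rcases B with _ | ⟨x, B⟩
    · simp at hbB
    · simp
  by_cases hBlong : e + 2 ≤ B.length
  · refine ⟨A.take (e + 2), B.take (e + 2), hA.take _, hB.take _, ?_, ⟨a, haU, ?_⟩,
      ⟨b, hbU, ?_⟩, by simp; omega, fun x hx => hAH x (List.mem_of_mem_take hx),
      fun x hx => hBH x (List.mem_of_mem_take hx)⟩
    · exact fun x hx hx' => hBA x (List.mem_of_mem_take hx') (List.mem_of_mem_take hx)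
    · rw [List.head?_take, if_neg (by omega)]; exact haA
    · rw [List.head?_take, if_neg (by omega)]; exact hbB
  -- Now `|A| ≤ 2e + 2` and `|B| ≤ e + 1`. All neighbours of the last vertex `w` of `B` lie in `A ∪
  -- B`, at least `e + 2 - |B|` of them in `A`. Maximality of `A` keeps their positions away from
  -- the first and last `|B|` places (else continue from `B` along `A` to one of its ends) and
  -- forbids consecutive ones (else insert `w`). There is no room for so many.
  exfalso
  set w := B[B.length - 1] with hw
  have hwB : w ∈ B := List.getElem_mem _
  have hlast : B.getLast? = some w := by
    rw [List.getLast?_eq_getElem?]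
    simp [hw, hBpos]
  have hclosed : ∀ y ∈ H, G.Adj w y → y ∈ A ∨ y ∈ B := by
    intro y hy hwy
    by_contra! hcon
    have := hBmax (B ++ [y]) ⟨hB.append (isPathList_singleton y) ?_ ?_, ?_, ?_, b, hbU, ?_⟩
    · simp at this
    · intro x hx hxy
      rw [List.mem_singleton] at hxy
      exact hcon.2 (hxy ▸ hx)
    · intro x hx z hz
      rw [hlast] at hx
      simp at hx hz
      subst hx hz
      exact hwy
    · simp only [List.mem_append, List.mem_singleton]
      rintro x (hx | rfl)
      exacts [hBH x hx, hy]
    · simp only [List.mem_append, List.mem_singleton]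
      rintro x (hx | rfl)
      exacts [hBA x hx, hcon.1]
    · rw [List.head?_append, hbB]; rfl
  let f : ℕ → V := fun i => A.getD i u₀
  have hf : ∀ i (hi : i < A.length), f i = A[i] := fun i hi => by simp [f, hi]
  let I := {i ∈ range A.length | G.Adj w (f i)}
  have hI : e + 1 ≤ I.card + (B.length - 1) := by
    refine (hdeg w (hBH w hwB)).trans ?_
    have hsub : {y ∈ H | G.Adj w y} ⊆ I.image f ∪ B.toFinset.erase w := by
      intro y hy
      rw [mem_filter] at hy
      rcases hclosed y hy.1 hy.2 with h | h
      · obtain ⟨i, hi, rfl⟩ := List.getElem_of_mem h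
        refine mem_union_left _ (mem_image.2 ⟨i, ?_, hf _ hi⟩)
        simp only [I, mem_filter, mem_range]
        exact ⟨hi, by rw [hf _ hi]; exact hy.2⟩
      · exact mem_union_right _ (mem_erase.2 ⟨hy.2.ne', by simpa using h⟩)
    refine (card_le_card hsub).trans ((card_union_le _ _).trans (add_le_add card_image_le ?_))
    rw [card_erase_of_mem (by simpa using hwB), List.toFinset_card_of_nodup hB.2]
  have hlow : ∀ i ∈ I, B.length ≤ i := by
    intro i hi
    simp only [I, mem_filter, mem_range] at hi
    rw [hf _ hi.1] at hi
    have := hAmax (B ++ A.drop i) ⟨hB.append (hA.drop i) ?_ ?_, ?_, b, hbU, ?_⟩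
    · simp at this; omega
    · exact fun x hx hx' => hBA x hx (List.mem_of_mem_drop hx')
    · intro x hx z hz
      rw [hlast] at hx
      rw [List.head?_drop] at hz
      simp [hi.1] at hx hz
      subst hx hz
      exact hi.2
    · simp only [List.mem_append]
      rintro x (hx | hx)
      exacts [hBH x hx, hAH x (List.mem_of_mem_drop hx)]
    · rw [List.head?_append, hbB]; rfl
  have hhigh : ∀ i ∈ I, i + 1 + B.length ≤ A.length := by
    intro i hi
    simp only [I, mem_filter, mem_range] at hi
    rw [hf _ hi.1] at hi
    have := hAmax (B ++ (A.take (i + 1)).reverse)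
      ⟨hB.append (hA.take _).reverse ?_ ?_, ?_, b, hbU, ?_⟩
    · simp at this; omega
    · exact fun x hx hx' => hBA x hx (List.mem_of_mem_take (List.mem_reverse.1 hx'))
    · intro x hx z hz
      rw [hlast] at hx
      rw [List.head?_reverse, List.getLast?_take, if_neg (by omega)] at hz
      simp [hi.1] at hx hz
      subst hx hz
      exact hi.2
    · simp only [List.mem_append, List.mem_reverse]
      rintro x (hx | hx)
      exacts [hBH x hx, hAH x (List.mem_of_mem_take hx)]
    · rw [List.head?_append, hbB]; rfl
  have hnext : ∀ i ∈ I, i + 1 ∉ I := by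
    intro i hi hi'
    simp only [I, mem_filter, mem_range] at hi hi'
    rw [hf _ hi.1] at hi
    rw [hf _ hi'.1] at hi'
    have hnd := hA.2
    rw [← List.take_append_drop (i + 1) A] at hnd
    have hdis := (List.nodup_append'.1 hnd).2.2
    have hwA : w ∉ A := hBA w hwB
    have := hAmax (A.take (i + 1) ++ (w :: A.drop (i + 1)))
      ⟨(hA.take _).append ((hA.drop _).cons ?_ ?_) ?_ ?_, ?_, a, haU, ?_⟩
    · simp at this; omega
    · exact fun h => hwA (List.mem_of_mem_drop h)
    · intro z hz
      rw [List.head?_drop] at hz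
      simp [hi'.1] at hz
      subst hz
      exact hi'.2
    · intro x hx hx'
      rcases List.mem_cons.1 hx' with rfl | hx'
      · exact hwA (List.mem_of_mem_take hx)
      · exact hdis hx hx'
    · intro x hx z hz
      rw [List.getLast?_take, if_neg (by omega)] at hx
      simp [hi.1] at hx hz
      subst hx hz
      exact hi.2.symm
    · simp only [List.mem_append, List.mem_cons]
      rintro x (hx | rfl | hx)
      exacts [hAH x (List.mem_of_mem_take hx), hBH _ hwB, hAH x (List.mem_of_mem_drop hx)]
    · rw [List.head?_append, List.head?_take, if_neg (by omega), haA]; rfl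
  have hcount : I.card + I.card ≤ A.length + 1 - B.length - B.length := by
    have hdis : Disjoint I (I.map (addRightEmbedding 1)) := by
      rw [disjoint_left]
      intro j hj hj'
      obtain ⟨i, hi, rfl⟩ := mem_map.1 hj'
      exact hnext i hi hj
    have hsub : I ∪ I.map (addRightEmbedding 1) ⊆ Ico B.length (A.length + 1 - B.length) := by
      refine union_subset ?_ ?_
      · intro i hi
        have := hlow i hi
        have := hhigh i hi
        exact mem_Ico.2 ⟨by omega, by omega⟩
      · intro j hj
        obtain ⟨i, hi, rfl⟩ := mem_map.1 hj
        have := hlow i hi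
        have := hhigh i hi
        exact mem_Ico.2 ⟨by simp; omega, by simp; omega⟩
    have := card_le_card hsub
    rw [card_union_of_disjoint hdis, card_map, Nat.card_Ico] at this
    omega
  omega

/-- A list of vertices in which any two have many common neighbours can be threaded by a path
whose connecting vertices avoid a given set. -/
theorem exists_threading [DecidableEq V] {Z : Finset V} :
    ∀ (zs : List V), zs ≠ [] → zs.Nodup → (∀ z ∈ zs, z ∈ Z) → ∀ F : Finset V,
      (∀ z ∈ zs, ∀ z' ∈ zs, ∃ Q : Finset V, zs.length ≤ Q.card + 1 ∧
        ∀ q ∈ Q, G.Adj z q ∧ G.Adj z' q ∧ q ∉ Z ∧ q ∉ F) →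
      ∃ W, IsPathList G W ∧ W.head? = zs.head? ∧ W.getLast? = zs.getLast? ∧
        W.length + 1 = 2 * zs.length ∧ ∀ x ∈ W, x ∈ zs ∨ (x ∉ Z ∧ x ∉ F)
  | [], h, _, _, _, _ => absurd rfl h
  | [z], _, _, _, _, _ => ⟨[z], isPathList_singleton z, rfl, rfl, rfl, by simp⟩
  | z :: z' :: zs, _, hnd, hZ, F, hQ => by
    obtain ⟨Q, hQc, hQp⟩ := hQ z (by simp) z' (by simp)
    obtain ⟨y, hy⟩ : Q.Nonempty := card_pos.1 (by simp at hQc; omega)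
    obtain ⟨hzy, hz'y, hyZ, hyF⟩ := hQp y hy
    rw [List.nodup_cons] at hnd
    -- The used connector `y` becomes forbidden; both sides of the bound on `Q` drop by one.
    obtain ⟨W, hW, hhead, hlast, hlen, hmem⟩ := exists_threading (z' :: zs) (by simp) hnd.2
      (fun x hx => hZ x (List.mem_cons_of_mem _ hx)) (insert y F) (by
        intro u hu u' hu'
        obtain ⟨Q', hQ'c, hQ'p⟩ := hQ u (List.mem_cons_of_mem _ hu) u' (List.mem_cons_of_mem _ hu')
        refine ⟨Q'.erase y, ?_, ?_⟩
        · have := pred_card_le_card_erase (s := Q') (a := y)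
          simp only [List.length_cons] at hQ'c ⊢
          omega
        · intro q hq
          obtain ⟨h1, h2, h3, h4⟩ := hQ'p q (mem_of_mem_erase hq)
          exact ⟨h1, h2, h3, by simp [ne_of_mem_erase hq, h4]⟩)
    have hyW : y ∉ W := by
      intro h
      rcases hmem y h with h | h
      · exact hyZ (hZ y (List.mem_cons_of_mem _ h))
      · simp at h
    have hzW : z ∉ W := by
      intro h
      rcases hmem z h with h | h
      · exact hnd.1 h
      · exact h.1 (hZ z (by simp))
    refine ⟨z :: y :: W, (hW.cons hyW ?_).cons ?_ ?_, rfl, ?_, ?_, ?_⟩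
    · intro x hx
      rw [hhead] at hx
      simp at hx
      subst hx
      exact hz'y.symm
    · rw [List.mem_cons, not_or]
      exact ⟨hzy.ne, hzW⟩
    · intro x hx
      simp at hx
      subst hx
      exact hzy
    · rw [List.getLast?_cons_cons, List.getLast?_cons_cons, ← hlast]
      rcases W with _ | ⟨x, W⟩
      · simp at hhead
      · rw [List.getLast?_cons_cons]
    · simp only [List.length_cons] at hlen ⊢
      omega
    · intro x hx
      rcases List.mem_cons.1 hx with rfl | hx
      · exact Or.inl (by simp)
      rcases List.mem_cons.1 hx with rfl | hx
      · exact Or.inr ⟨hyZ, hyF⟩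
      rcases hmem x hx with h | h
      · exact Or.inl (List.mem_cons_of_mem _ h)
      · exact Or.inr ⟨h.1, fun h' => h.2 (mem_insert_of_mem h')⟩

/-- `heq` removes the only obstruction: equal ends are possible only when `Z` is a single vertex. -/
theorem exists_list_with_ends [DecidableEq V] {Z : Finset V} {z₁ z₂ : V} (h₁ : z₁ ∈ Z)
    (h₂ : z₂ ∈ Z) (heq : z₁ = z₂ → Z = {z₁}) :
    ∃ zs : List V, zs.Nodup ∧ (∀ x, x ∈ zs ↔ x ∈ Z) ∧ zs.length = Z.card ∧
      zs.head? = some z₁ ∧ zs.getLast? = some z₂ := by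
  have hkey : ∀ zs : List V, zs.Nodup → (∀ x, x ∈ zs ↔ x ∈ Z) → zs.length = Z.card := by
    intro zs hnd hmem
    rw [← List.toFinset_card_of_nodup hnd]
    congr 1
    ext x
    simp [hmem]
  by_cases h : z₁ = z₂
  · have := heq h
    subst h
    refine ⟨[z₁], by simp, by simp [this], by simp [this], rfl, rfl⟩
  · have hnd : (z₁ :: (((Z.erase z₁).erase z₂).toList ++ [z₂])).Nodup := by
      rw [List.nodup_cons, List.nodup_append']
      refine ⟨by simp [h], Finset.nodup_toList _, by simp, ?_⟩
      intro x hx hx'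
      simp at hx hx'
      exact hx.1 hx'
    have hmem : ∀ x, x ∈ z₁ :: (((Z.erase z₁).erase z₂).toList ++ [z₂]) ↔ x ∈ Z := by
      intro x
      by_cases hx1 : x = z₁
      · simp [hx1, h₁]
      · by_cases hx2 : x = z₂
        · simp [hx2, h₂]
        · simp [hx1, hx2]
    refine ⟨_, hnd, hmem, hkey _ hnd hmem, rfl, ?_⟩
    rw [← List.cons_append, List.getLast?_append]
    simp

/-- Two disjoint paths joined through a set `Z` whose members pairwise have many common
neighbours. -/
theorem exists_path_through [DecidableEq V] {Z : Finset V} {z₁ z₂ : V} (h₁ : z₁ ∈ Z)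
    (h₂ : z₂ ∈ Z) (heq : z₁ = z₂ → Z = {z₁}) {A B : List V} (hA : IsPathList G A)
    (hB : IsPathList G B) (hAB : ∀ x ∈ A, x ∉ B) (hAZ : ∀ x ∈ A, x ∉ Z) (hBZ : ∀ x ∈ B, x ∉ Z)
    (hA₁ : ∀ a ∈ A.head?, G.Adj z₁ a) (hB₂ : ∀ b ∈ B.head?, G.Adj z₂ b)
    (hQ : ∀ z ∈ Z, ∀ z' ∈ Z, ∃ Q : Finset V, Z.card + A.length + B.length ≤ Q.card + 1 ∧
      ∀ q ∈ Q, G.Adj z q ∧ G.Adj z' q ∧ q ∉ Z) :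
    ∃ l, IsPathList G l ∧ l.length + 1 = A.length + B.length + 2 * Z.card := by
  obtain ⟨zs, hnd, hmem, hlen, hhead, hlast⟩ := exists_list_with_ends h₁ h₂ heq
  have hne : zs ≠ [] := by rintro rfl; simp at hhead
  obtain ⟨W, hW, hWhead, hWlast, hWlen, hWmem⟩ := exists_threading (G := G) zs hne hnd
    (fun z hz => (hmem z).1 hz) (A.toFinset ∪ B.toFinset) (by
      intro z hz z' hz'
      obtain ⟨Q, hQc, hQp⟩ := hQ z ((hmem z).1 hz) z' ((hmem z').1 hz')
      refine ⟨Q \ (A.toFinset ∪ B.toFinset), ?_, ?_⟩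
      · have h1 := le_card_sdiff (A.toFinset ∪ B.toFinset) Q
        have h2 := card_union_le A.toFinset B.toFinset
        have h3 := List.toFinset_card_le A
        have h4 := List.toFinset_card_le B
        omega
      · intro q hq
        rw [mem_sdiff] at hq
        obtain ⟨h1, h2, h3⟩ := hQp q hq.1
        exact ⟨h1, h2, h3, hq.2⟩)
  have hAW : ∀ x ∈ A, x ∉ W := by
    intro x hx hxW
    rcases hWmem x hxW with h | h
    · exact hAZ x hx ((hmem x).1 h)
    · exact h.2 (by simp [hx])
  have hBW : ∀ x ∈ B, x ∉ W := by
    intro x hx hxW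
    rcases hWmem x hxW with h | h
    · exact hBZ x hx ((hmem x).1 h)
    · exact h.2 (by simp [hx])
  -- Arms are listed outwards from their point of attachment, so the first is reversed.
  refine ⟨A.reverse ++ (W ++ B), hA.reverse.append (hW.append hB ?_ ?_) ?_ ?_, ?_⟩
  · exact fun x hx hx' => hBW x hx' hx
  · intro x hx y hy
    rw [hWlast, hlast] at hx
    cases hx
    exact hB₂ y hy
  · intro x hx hx'
    rw [List.mem_reverse] at hx
    rcases List.mem_append.1 hx' with h | h
    · exact hAW x hx h
    · exact hAB x hx h
  · intro x hx y hy
    rw [List.getLast?_reverse] at hx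
    rw [List.head?_append, hWhead, hhead] at hy
    cases hy
    exact (hA₁ x hx).symm
  · simp
    omega

end Arms

/-! ### A Tutte–Berge alternative for non-edges. -/

section Matching

variable {V : Type*}

/-- If a graph on `S` together with some universal vertices has a perfect matching, the graph
itself has a large matching. -/
theorem exists_matching_of_perfect [LinearOrder V] (G : SimpleGraph V) (S : Finset V) {m j : ℕ}
    (hj : S.card = 2 * m + j)
    {M : (graphJoin (Gᶜ.induce (S : Set V)) (⊤ : SimpleGraph (Fin j))).Subgraph}
    (hM : M.IsPerfectMatching) :
    ∃ f : Fin m × Fin 2 → V, f.Injective ∧ (∀ p, f p ∈ S) ∧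
      ∀ i, ¬ G.Adj (f (i, 0)) (f (i, 1)) := by
  classical
  have hex : ∀ w, ∃ w', M.Adj w w' ∧ ∀ y, M.Adj w y → y = w' := fun w => hM.1 (hM.2 w)
  choose g hg hguniq using hex
  have hgg : ∀ w, g (g w) = w := fun w => (hguniq _ _ (hg w).symm).symm
  have hginj : g.Injective := fun a b hab => by rw [← hgg a, hab, hgg]
  have hgl : Function.Injective fun a : (S : Set V) => g (Sum.inl a) :=
    hginj.comp Sum.inl_injective
  -- `Q` and `Q'` are the lower and upper ends of matching edges inside `S`, and `R` is matched to
  -- universal vertices. Since `|Q'| ≤ |Q|` and `|R| ≤ j`, `|S| = 2m + j` forces `|Q| ≥ m`.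
  let Q : Finset (S : Set V) := univ.filter fun a => ∃ b, g (Sum.inl a) = Sum.inl b ∧ a < b
  let Q' : Finset (S : Set V) := univ.filter fun a => ∃ b, g (Sum.inl a) = Sum.inl b ∧ b < a
  let R : Finset (S : Set V) := univ.filter fun a => ∃ b, g (Sum.inl a) = Sum.inr b
  have hcover : (univ : Finset (S : Set V)) ⊆ Q ∪ Q' ∪ R := by
    intro a _
    rcases hga : g (Sum.inl a) with b | b
    · have hne : a ≠ b := by
        rintro rfl
        have := hg (Sum.inl a)
        rw [hga] at this
        exact this.ne rfl
      rcases lt_or_gt_of_ne hne with h | h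
      · exact mem_union_left _ (mem_union_left _ (mem_filter.2 ⟨mem_univ _, b, hga, h⟩))
      · exact mem_union_left _ (mem_union_right _ (mem_filter.2 ⟨mem_univ _, b, hga, h⟩))
    · simp [R, hga]
  have hQ' : Q'.card ≤ Q.card := by
    have hmem : ∀ a ∈ Q'.image (fun a => g (Sum.inl a)), a ∈ Q.image Sum.inl := by
      intro w hw
      obtain ⟨a, ha, rfl⟩ := mem_image.1 hw
      simp only [Q', mem_filter, mem_univ, true_and] at ha
      obtain ⟨b, hb, hba⟩ := ha
      refine mem_image.2 ⟨b, ?_, hb.symm⟩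
      simp only [Q, mem_filter, mem_univ, true_and]
      exact ⟨a, by rw [← hb, hgg], hba⟩
    have := card_le_card hmem
    rwa [card_image_of_injective _ hgl,
      card_image_of_injective _ Sum.inl_injective] at this
  have hR : R.card ≤ j := by
    have hmem : ∀ a ∈ R.image (fun a => g (Sum.inl a)),
        a ∈ (univ : Finset (Fin j)).image Sum.inr := by
      intro w hw
      obtain ⟨a, ha, rfl⟩ := mem_image.1 hw
      simp only [R, mem_filter, mem_univ, true_and] at ha
      obtain ⟨b, hb⟩ := ha
      exact mem_image.2 ⟨b, mem_univ _, hb.symm⟩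
    have := card_le_card hmem
    rwa [card_image_of_injective _ hgl,
      card_image_of_injective _ Sum.inr_injective, card_univ, Fintype.card_fin] at this
  have hcard : S.card ≤ Q.card + Q'.card + R.card := by
    have h1 := card_le_card hcover
    have h2 := card_union_le (Q ∪ Q') R
    have h3 := card_union_le Q Q'
    have h4 : Fintype.card (S : Set V) = S.card := by simp
    rw [card_univ, h4] at h1
    omega
  have hm : m ≤ Q.card := by omega
  obtain ⟨Q₀, hQ₀, hQ₀c⟩ := exists_subset_card_eq hm
  let e : Fin m ≃ Q₀ := (Q₀.equivFinOfCardEq hQ₀c).symm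
  have hb : ∀ i, ∃ b : (S : Set V), g (Sum.inl (e i).1) = Sum.inl b ∧ (e i).1 < b := by
    intro i
    have := hQ₀ (e i).2
    simpa only [Q, mem_filter, mem_univ, true_and] using this
  choose b hb hlt using hb
  have hbinj : ∀ i k, b i = b k → i = k := by
    intro i k h
    have : g (Sum.inl (e i).1) = g (Sum.inl (e k).1) := by rw [hb, hb, h]
    exact e.injective (Subtype.ext (Sum.inl_injective (hginj this)))
  have heb : ∀ i k, (e i).1 ≠ b k := by
    intro i k h
    have h1 : g (Sum.inl (e i).1) = Sum.inl (e k).1 := by rw [h, ← hb, hgg]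
    have h2 : b i = (e k).1 := Sum.inl_injective ((hb i).symm.trans h1)
    have := hlt i
    rw [h2, h] at this
    exact lt_asymm this (hlt k)
  refine ⟨fun p => if p.2 = 0 then (e p.1).1 else b p.1, ?_, ?_, ?_⟩
  · rintro ⟨i, x⟩ ⟨k, y⟩ h
    fin_cases x <;> fin_cases y <;> simp at h ⊢
    · exact h
    · exact heb _ _ h
    · exact heb _ _ h.symm
    · exact hbinj _ _ h
  · rintro ⟨i, x⟩
    fin_cases x
    · simp
    · simp
  · intro i
    have h1 := (hg (Sum.inl (e i).1)).adj_sub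
    rw [hb] at h1
    have h2 : (Gᶜ.induce (S : Set V)).Adj (e i).1 (b i) := h1
    rw [SimpleGraph.comap_adj, SimpleGraph.compl_adj] at h2
    simpa using h2.2

/-- The Tutte–Berge alternative for the complement of `G` on a vertex set `S`. -/
theorem exists_matching_or_multipartite {V : Type} [Fintype V] [LinearOrder V] (G : SimpleGraph V)
    (S : Finset V) {m : ℕ} (hm : 2 * m ≤ S.card) :
    (∃ f : Fin m × Fin 2 → V, f.Injective ∧ (∀ p, f p ∈ S) ∧
      ∀ i, ¬ G.Adj (f (i, 0)) (f (i, 1))) ∨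
    ∃ (ι : Type) (_ : DecidableEq ι) (c : V → ι) (T : Finset V), T ⊆ S ∧
      (∀ x ∈ S \ T, ∀ y ∈ S \ T, c x ≠ c y → G.Adj x y) ∧
      T.card + S.card + 2 ≤ 2 * m + ((S \ T).image c).card := by
  classical
  obtain ⟨j, hj⟩ := Nat.exists_eq_add_of_le hm
  -- The `j = |S| - 2m` universal vertices absorb the permitted deficiency, which reduces
  -- Tutte–Berge to Tutte's theorem.
  set K := graphJoin (Gᶜ.induce (S : Set V)) (⊤ : SimpleGraph (Fin j)) with hK
  by_cases hPM : ∃ M : K.Subgraph, M.IsPerfectMatching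
  · obtain ⟨M, hM⟩ := hPM
    exact Or.inl (exists_matching_of_perfect G S hj hM)
  right
  rw [SimpleGraph.tutte] at hPM
  push Not at hPM
  obtain ⟨u, hu⟩ := hPM
  unfold SimpleGraph.IsTutteViolator at hu
  set Y := (⊤ : K.Subgraph).deleteVerts u with hY
  have hYv : Y.verts = uᶜ := by ext; simp [hY]
  have hYm : ∀ a, a ∈ Y.verts ↔ a ∉ u := fun a => by rw [hYv, Set.mem_compl_iff]
  have hYadj : ∀ a b : Y.verts, K.Adj a b → Y.coe.Adj a b := by
    intro a b hab
    have ha : a.1 ∉ u := (hYm _).1 a.2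
    have hb : b.1 ∉ u := (hYm _).1 b.2
    exact SimpleGraph.Subgraph.deleteVerts_adj.2 ⟨Set.mem_univ _, ha, Set.mem_univ _, hb, hab⟩
  have hpar := SimpleGraph.odd_ncard_oddComponents (G := Y.coe)
  have hcW : Nat.card ((S : Set V) ⊕ Fin j) = S.card + j := by simp
  have hcY : Nat.card Y.verts + u.ncard = S.card + j := by
    rw [← hcW, ← Set.ncard_add_ncard_compl u, hYv, Nat.card_coe_set_eq, add_comm]
  -- A universal vertex outside `u` makes `K - u` connected. Then there is exactly one odd component
  -- and `u` is empty, although the total order `2m + 2j` is even.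
  have huniv : ∀ i, Sum.inr i ∈ u := by
    intro i
    by_contra hi
    have hiY : Sum.inr i ∈ Y.verts := by rw [hYv]; exact hi
    have hreach : ∀ a : Y.verts, Y.coe.Reachable a ⟨Sum.inr i, hiY⟩ := by
      rintro ⟨a, ha⟩
      by_cases hai : a = Sum.inr i
      · subst hai; exact SimpleGraph.Reachable.refl _
      · refine (hYadj ⟨a, ha⟩ ⟨Sum.inr i, hiY⟩ ?_).reachable
        rcases a with a | a
        · trivial
        · show a ≠ i
          rintro rfl
          exact hai rfl
    have hle : Y.coe.oddComponents.ncard ≤ 1 := by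
      rw [Set.ncard_le_one_iff]
      intro a b _ _
      induction a using SimpleGraph.ConnectedComponent.ind with | _ a
      induction b using SimpleGraph.ConnectedComponent.ind with | _ b
      rw [SimpleGraph.ConnectedComponent.eq]
      exact (hreach a).trans (hreach b).symm
    have h1 : Y.coe.oddComponents.ncard = 1 := by omega
    have h2 : u.ncard = 0 := by omega
    rw [h1] at hpar
    have h3 := hpar.1 odd_one
    rw [Nat.odd_iff] at h3
    omega
  let T : Finset V := S.filter fun x => ∃ h : x ∈ S, (Sum.inl ⟨x, h⟩ : (S : Set V) ⊕ Fin j) ∈ u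
  have hTu : u.ncard = T.card + j := by
    have hu' : u = ((T.subtype (· ∈ (S : Set V))).disjSum (univ : Finset (Fin j)) :
        Finset ((S : Set V) ⊕ Fin j)) := by
      ext a
      rcases a with a | a
      · have := a.2
        simp [T]
      · simp [huniv a]
    rw [hu', Set.ncard_coe_finset, card_disjSum, card_univ, Fintype.card_fin, card_subtype]
    congr 2
    ext x
    simp only [T, mem_filter, mem_coe]
    tauto
  have hTY : ∀ x, x ∈ S \ T → ∃ h : x ∈ S, (Sum.inl ⟨x, h⟩ : (S : Set V) ⊕ Fin j) ∈ Y.verts := by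
    intro x hx
    simp only [T, mem_sdiff, mem_filter, not_and, not_exists] at hx
    exact ⟨hx.1, by rw [hYv]; exact hx.2 hx.1 hx.1⟩
  let c : V → Option Y.coe.ConnectedComponent := fun x =>
    if h : x ∈ S \ T then some (Y.coe.connectedComponentMk ⟨_, (hTY x h).2⟩) else none
  refine ⟨Option Y.coe.ConnectedComponent, inferInstance, c, T, filter_subset _ _, ?_, ?_⟩
  · intro x hx y hy hne
    by_contra hxy
    apply hne
    by_cases hxe : x = y
    · rw [hxe]
    simp only [c, dif_pos hx, dif_pos hy]
    congr 1
    rw [SimpleGraph.ConnectedComponent.eq]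
    refine (hYadj _ _ ?_).reachable
    show (Gᶜ.induce (S : Set V)).Adj _ _
    rw [SimpleGraph.comap_adj, SimpleGraph.compl_adj]
    exact ⟨hxe, hxy⟩
  · have hp : Y.coe.oddComponents.ncard ≤ ((S \ T).image c).card := by
      rw [← Set.ncard_coe_finset, ← Set.ncard_image_of_injective _ (Option.some_injective _)]
      refine Set.ncard_le_ncard ?_ (Finset.finite_toSet _)
      rintro _ ⟨κ, -, rfl⟩
      induction κ using SimpleGraph.ConnectedComponent.ind with | _ a
      obtain ⟨a, ha⟩ := a
      rcases a with ⟨x, hxS⟩ | i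
      · have hxST : x ∈ S \ T := by
          rw [hYv] at ha
          simp only [T, mem_sdiff, mem_filter, not_and, not_exists]
          exact ⟨hxS, fun _ _ => ha⟩
        rw [mem_coe, mem_image]
        exact ⟨x, hxST, by simp only [c, dif_pos hxST]⟩
      · rw [hYv] at ha
        exact absurd (huniv i) ha
    -- The number of odd components has the parity of `|u|`, so exceeding `|u|` means being at least
    -- `|u| + 2`.
    rw [Nat.odd_iff, Nat.odd_iff] at hpar
    have hTS : T.card ≤ S.card := card_le_card (filter_subset _ _)
    omega

end Matching

/-! ### What the absence of a fan says about non-neighbourhoods. -/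

section Fan

variable {V : Type} {G : SimpleGraph V}

theorem fanGraph_isContained_compl {m : ℕ} {v : V} {f : Fin m × Fin 2 → V} (hf : f.Injective)
    (hv : ∀ p, f p ≠ v ∧ ¬ G.Adj v (f p)) (hadj : ∀ i, ¬ G.Adj (f (i, 0)) (f (i, 1))) :
    (fanGraph m).IsContained Gᶜ := by
  have hvp : ∀ p, Gᶜ.Adj v (f p) := fun p => by
    rw [SimpleGraph.compl_adj]
    exact ⟨(hv p).1.symm, (hv p).2⟩
  refine ⟨⟨⟨Sum.elim (fun _ => v) f, ?_⟩, ?_⟩⟩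
  · rintro (a | ⟨i, x⟩) (b | ⟨k, y⟩) h
    · have h' : a ≠ b := h
      exact absurd (Subsingleton.elim a b) h'
    · exact hvp _
    · exact (hvp _).symm
    · obtain ⟨h1, h2⟩ : i = k ∧ x ≠ y := h
      subst h1
      show Gᶜ.Adj (f (i, x)) (f (i, y))
      rw [SimpleGraph.compl_adj]
      refine ⟨fun he => h2 (congrArg Prod.snd (hf he)), ?_⟩
      fin_cases x <;> fin_cases y
      · exact absurd rfl h2
      · exact hadj i
      · exact fun h => hadj i h.symm
      · exact absurd rfl h2
  · rintro (a | p) (b | q) h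
    · rw [Subsingleton.elim a b]
    · exact absurd h.symm (hv q).1
    · exact absurd h (hv p).1
    · exact congrArg Sum.inr (hf h)

/-- `m` disjoint non-edges among the non-neighbours of `v` would form a fan with hub `v`, so the
second Tutte–Berge alternative holds. -/
theorem exists_multipartite_of_not_fan [Fintype V] [LinearOrder V] {m : ℕ}
    (hfan : ¬ (fanGraph m).IsContained Gᶜ) {v : V} {S : Finset V}
    (hS : ∀ x ∈ S, x ≠ v ∧ ¬ G.Adj v x) (hm : 2 * m ≤ S.card) :
    ∃ (ι : Type) (_ : DecidableEq ι) (c : V → ι) (T : Finset V), T ⊆ S ∧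
      (∀ x ∈ S \ T, ∀ y ∈ S \ T, c x ≠ c y → G.Adj x y) ∧
      T.card + S.card + 2 ≤ 2 * m + ((S \ T).image c).card := by
  rcases exists_matching_or_multipartite G S hm with ⟨f, hf, hfS, hadj⟩ | h
  · exact absurd (fanGraph_isContained_compl hf (fun p => hS _ (hfS p)) hadj) hfan
  · exact h

/-- Connectedness of a graph containing a complete multipartite graph with at least two classes:
vertices of one class are linked through another class. -/
theorem mem_of_multipartite {ι : Type} {c : V → ι} {X Y : Finset V}
    (hX : ∀ x ∈ X, ∀ y ∈ X, c x ≠ c y → G.Adj x y) (hc : ∀ x ∈ X, ∃ w ∈ X, c w ≠ c x)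
    (hY : ∀ y ∈ Y, ∀ x ∈ X, G.Adj y x → x ∈ Y) {x₀ : V} (hx₀ : x₀ ∈ X) (hx₀Y : x₀ ∈ Y) :
    X ⊆ Y := by
  intro x hx
  by_cases h : c x₀ = c x
  · obtain ⟨w, hw, hwc⟩ := hc x₀ hx₀
    have hwY : w ∈ Y := hY x₀ hx₀Y w hw (hX x₀ hx₀ w hw hwc.symm)
    exact hY w hwY x hx (hX w hw x hx (by rwa [← h]))
  · exact hY x₀ hx₀Y x hx (hX x₀ hx₀ x hx h)

/-- In a graph without long paths whose complement has no fan, a vertex `v` of small degree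
misses a nonempty set `D` of vertices adjacent to nearly everything. -/
theorem exists_dominating_set [Fintype V] [LinearOrder V] [DecidableRel G.Adj] {n m s : ℕ}
    (hs : 2 * s + 2 ≤ n) (hs' : n ≤ 2 * s + 3) (hpath : ∀ l, IsPathList G l → l.length < n)
    (hfan : ¬ (fanGraph m).IsContained Gᶜ) (hN : 2 * m + s + 1 ≤ Fintype.card V) {v : V}
    (hd : (G.neighborFinset v).card ≤ s)
    (hM : n + (G.neighborFinset v).card + m ≤ Fintype.card V) :
    ∃ D T : Finset V, (∀ x ∈ D, x ≠ v ∧ ¬ G.Adj v x) ∧ D.card ≤ s ∧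
      T.card + Fintype.card V ≤ D.card + (G.neighborFinset v).card + 2 * m ∧
      (∀ z ∈ D, ∀ x, x ∉ D → x ∉ T → x ≠ v → ¬ G.Adj v x → G.Adj z x) ∧
      (∀ z ∈ D, ({x | x ≠ v ∧ ¬ G.Adj v x ∧ ¬ G.Adj z x} : Finset V).card + Fintype.card V ≤
        D.card + (G.neighborFinset v).card + 2 * m + 1) ∧
      (∀ x ∈ D, x ∉ T) ∧
      ∀ C : Finset V, n ≤ C.card → (∀ x ∈ C, ∀ y, G.Adj x y → y ∈ C) →
        ∀ x, x ∉ T → x ≠ v → ¬ G.Adj v x → x ∈ C := by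
  set S : Finset V := {x | x ≠ v ∧ ¬ G.Adj v x} with hS
  have hScard : S.card + (G.neighborFinset v).card + 1 = Fintype.card V := by
    have hSc : Sᶜ = insert v (G.neighborFinset v) := by
      ext x
      simp only [hS, mem_compl, mem_filter, mem_univ, true_and, mem_insert,
        SimpleGraph.mem_neighborFinset]
      tauto
    have := card_add_card_compl S
    rw [hSc, card_insert_of_notMem (by simp)] at this
    omega
  obtain ⟨ι, _, c, T, hTS, hX, hp⟩ := exists_multipartite_of_not_fan hfan (v := v) (S := S)
    (by simp [hS]) (by omega)
  set X := S \ T with hXdef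
  have hXcard : X.card + T.card = S.card := card_sdiff_add_card_eq_card hTS
  have hpX : (X.image c).card ≤ X.card := card_image_le
  -- Otherwise `X` is connected with all degrees above `s`, and Dirac's argument gives a long path.
  -- Hence one class contains all but at most `s` vertices of `X`, and `D` is the rest.
  obtain ⟨z₀, hz₀, hDs⟩ : ∃ z₀ ∈ X, {x ∈ X | c x ≠ c z₀}.card ≤ s := by
    by_contra! hcon
    obtain ⟨l, hl, hlen⟩ := exists_long_path_of_degree (G := G) hs' (X := X) (by omega) (by omega)
      (fun Y hYX ⟨y, hy⟩ hYc => mem_of_multipartite hX (fun x hx => by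
        obtain ⟨w, hw⟩ := card_pos.1 ((Nat.zero_le _).trans_lt (hcon x hx))
        exact ⟨w, (mem_filter.1 hw).1, (mem_filter.1 hw).2⟩) hYc (hYX hy) hy)
      (fun x hx => Nat.lt_of_lt_of_le (hcon x hx) (card_le_card fun y hy => by
        rw [mem_filter] at hy ⊢
        exact ⟨hy.1, hX x hx y hy.1 (Ne.symm hy.2)⟩))
    have := hpath l hl
    omega
  set D := {x ∈ X | c x ≠ c z₀} with hD
  have hpD : (X.image c).card ≤ D.card + 1 := by
    have hsub : X.image c ⊆ insert (c z₀) (D.image c) := by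
      intro i hi
      obtain ⟨x, hx, rfl⟩ := mem_image.1 hi
      by_cases h : c x = c z₀
      · exact mem_insert.2 (Or.inl h)
      · exact mem_insert_of_mem (mem_image_of_mem _ (mem_filter.2 ⟨hx, h⟩))
    have h1 := card_le_card hsub
    have h2 := card_insert_le (c z₀) (D.image c)
    have h3 : (D.image c).card ≤ D.card := card_image_le
    omega
  have hXmem : ∀ x, x ∈ X ↔ (x ≠ v ∧ ¬ G.Adj v x) ∧ x ∉ T := by
    intro x
    simp [hXdef, hS]
  refine ⟨D, T, fun x hx => ((hXmem x).1 (mem_filter.1 hx).1).1, hDs, by omega, ?_, ?_, ?_, ?_⟩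
  · intro z hz x hxD hxT hxv hvx
    have hxX : x ∈ X := (hXmem x).2 ⟨⟨hxv, hvx⟩, hxT⟩
    rw [hD, mem_filter] at hz
    refine hX z hz.1 x hxX ?_
    have : c x = c z₀ := by
      by_contra h
      exact hxD (mem_filter.2 ⟨hxX, h⟩)
    rw [this]
    exact hz.2
  · intro z hz
    have hsub : ({x | x ≠ v ∧ ¬ G.Adj v x ∧ ¬ G.Adj z x} : Finset V) ⊆
        T ∪ {x ∈ D | c x = c z} := by
      intro x hx
      simp only [mem_filter, mem_univ, true_and] at hx
      by_cases hxT : x ∈ T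
      · exact mem_union_left _ hxT
      have hxX : x ∈ X := (hXmem x).2 ⟨⟨hx.1, hx.2.1⟩, hxT⟩
      rw [hD, mem_filter] at hz
      have hxz : c x = c z := by
        by_contra h
        exact hx.2.2 (hX z hz.1 x hxX (Ne.symm h))
      exact mem_union_right _ (mem_filter.2 ⟨mem_filter.2 ⟨hxX, by rw [hxz]; exact hz.2⟩, hxz⟩)
    -- Count classes: that of `z₀`, that of `z`, and at most one per other vertex of `D`. As classes
    -- are many, the class of `z` is small.
    have hsub' : X.image c ⊆ insert (c z₀) (insert (c z) ({x ∈ D | ¬ c x = c z}.image c)) := by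
      intro i hi
      obtain ⟨x, hx, rfl⟩ := mem_image.1 hi
      by_cases h : c x = c z₀
      · exact mem_insert.2 (Or.inl h)
      by_cases h' : c x = c z
      · exact mem_insert_of_mem (mem_insert.2 (Or.inl h'))
      · exact mem_insert_of_mem (mem_insert_of_mem (mem_image_of_mem _
          (mem_filter.2 ⟨mem_filter.2 ⟨hx, h⟩, h'⟩)))
    have h1 := (card_le_card hsub).trans (card_union_le _ _)
    have h2 := (card_le_card hsub').trans (card_insert_le _ _)
    have h3 := card_insert_le (c z) ({x ∈ D | ¬ c x = c z}.image c)
    have h4 : ({x ∈ D | ¬ c x = c z}.image c).card ≤ {x ∈ D | ¬ c x = c z}.card := card_image_le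
    have h5 := card_filter_add_card_filter_not (s := D) (fun x => c x = c z)
    omega
  · exact fun x hx => ((hXmem x).1 (mem_filter.1 hx).1).2
  · intro C hC hclosed
    -- `D` supplies a second class, so `X` is connected, and `X` is too large to miss `C`.
    obtain ⟨z, hz⟩ : D.Nonempty := card_pos.1 (by omega)
    rw [hD, mem_filter] at hz
    obtain ⟨x₀, hx₀⟩ : (X ∩ C).Nonempty := by
      have h1 := card_union_add_card_inter X C
      have h2 := card_le_univ (X ∪ C)
      exact card_pos.1 (by omega)
    rw [mem_inter] at hx₀
    have hXC : X ⊆ C := mem_of_multipartite hX (fun x _ => by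
      by_cases h : c x = c z₀
      · exact ⟨z, hz.1, by rw [h]; exact hz.2⟩
      · exact ⟨z₀, hz₀, Ne.symm h⟩) (fun y hy x _ hyx => hclosed y hy x hyx) hx₀.1 hx₀.2
    exact fun x hxT hxv hvx => hXC ((hXmem x).2 ⟨⟨hxv, hvx⟩, hxT⟩)

end Fan

/-! ### Linked sets and the case `n ≤ m`. -/

section Linked

variable {V : Type} {G : SimpleGraph V}

/-- Every member of `Z` is adjacent to nearly everything outside `Z`, and any two members have
many common neighbours outside `Z`. -/
structure IsLinked [Fintype V] [DecidableEq V] (G : SimpleGraph V) [DecidableRel G.Adj] (s : ℕ)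
    (Z : Finset V) : Prop where
  nonadj : ∀ z ∈ Z, ({x | x ∉ Z ∧ ¬ G.Adj z x} : Finset V).card ≤ s + Z.card
  common : ∀ z ∈ Z, ∀ z' ∈ Z,
    2 * s + 3 ≤ ({x | x ∉ Z ∧ G.Adj z x ∧ G.Adj z' x} : Finset V).card + Z.card

theorem card_le_common_add [Fintype V] [DecidableEq V] [DecidableRel G.Adj] {Z R : Finset V}
    {a b : V} (h : ∀ x, x ∉ Z → x ∉ R → G.Adj a x ∧ G.Adj b x) :
    Fintype.card V ≤ ({x | x ∉ Z ∧ G.Adj a x ∧ G.Adj b x} : Finset V).card + Z.card + R.card := by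
  have hsub : (univ : Finset V) ⊆
      ({x | x ∉ Z ∧ G.Adj a x ∧ G.Adj b x} : Finset V) ∪ Z ∪ R := by
    intro x _
    by_cases hZ : x ∈ Z
    · exact mem_union_left _ (mem_union_right _ hZ)
    by_cases hR : x ∈ R
    · exact mem_union_right _ hR
    · exact mem_union_left _ (mem_union_left _ (mem_filter.2 ⟨mem_univ _, hZ, h x hZ hR⟩))
  have h1 := card_le_card hsub
  have h2 := card_union_le (({x | x ∉ Z ∧ G.Adj a x ∧ G.Adj b x} : Finset V) ∪ Z) R
  have h3 := card_union_le ({x | x ∉ Z ∧ G.Adj a x ∧ G.Adj b x} : Finset V) Z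
  rw [card_univ] at h1
  omega

theorem exists_ends {Z : Finset V} (hZ : Z.Nonempty) :
    ∃ z₁ ∈ Z, ∃ z₂ ∈ Z, z₁ = z₂ → Z = {z₁} := by
  by_cases h : 1 < Z.card
  · obtain ⟨a, ha, b, hb, hab⟩ := one_lt_card.1 h
    exact ⟨a, ha, b, hb, fun h => absurd h hab⟩
  · have : Z.card = 1 := by have := card_pos.2 hZ; omega
    obtain ⟨a, rfl⟩ := card_eq_one.1 this
    exact ⟨a, by simp, a, by simp, fun _ => rfl⟩

/-- The path alternates: `s + 1` members of `Z`, `s` connectors, and one further common neighbour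
beyond each end, treated as a one-vertex arm. -/
theorem exists_path_of_common [Fintype V] [DecidableEq V] [DecidableRel G.Adj] {s : ℕ}
    {Z : Finset V} (hZ : Z.card = s + 1)
    (hQ : ∀ z ∈ Z, ∀ z' ∈ Z,
      s + 2 ≤ ({x | x ∉ Z ∧ G.Adj z x ∧ G.Adj z' x} : Finset V).card) :
    ∃ l, IsPathList G l ∧ l.length = 2 * s + 3 := by
  obtain ⟨z₁, h₁, z₂, h₂, heq⟩ := exists_ends (Z := Z) (card_pos.1 (by omega))
  obtain ⟨a, ha, b, hb, hab⟩ := one_lt_card.1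
    (show 1 < ({x | x ∉ Z ∧ G.Adj z₁ x ∧ G.Adj z₂ x} : Finset V).card by
      have := hQ z₁ h₁ z₂ h₂
      omega)
  simp only [mem_filter, mem_univ, true_and] at ha hb
  obtain ⟨l, hl, hlen⟩ := exists_path_through h₁ h₂ heq (isPathList_singleton (G := G) a)
    (isPathList_singleton b) (by simpa using hab) (by simpa using ha.1) (by simpa using hb.1)
    (by simpa using ha.2.1) (by simpa using hb.2.2) (fun z hz z' hz' =>
      ⟨({x | x ∉ Z ∧ G.Adj z x ∧ G.Adj z' x} : Finset V), by
        have := hQ z hz z' hz'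
        rw [List.length_singleton, List.length_singleton]
        omega, fun q hq => by
        rw [mem_filter] at hq
        exact ⟨hq.2.2.1, hq.2.2.2, hq.2.1⟩⟩)
  refine ⟨l, hl, ?_⟩
  simp only [List.length_singleton] at hlen
  omega

section Extend

variable [Fintype V] [DecidableEq V] [DecidableRel G.Adj] {m s : ℕ} {Z D T : Finset V} {v : V}

/-- `Z ∩ D` and `Z ∩ N(v)` are disjoint parts of `Z`. When `|D| + deg v > s` and `|N(v) \ Z| ≤ s -
|Z|`, this makes `Z ∪ D` strictly larger than `Z`. -/
theorem card_union_dominating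
    (hDv : ∀ x ∈ D, x ≠ v ∧ ¬ G.Adj v x) :
    D.card + (G.neighborFinset v).card ≤ (Z ∪ D).card + (G.neighborFinset v \ Z).card := by
  have h1 := card_union_add_card_inter Z D
  have h2 := card_sdiff_add_card_inter (G.neighborFinset v) Z
  have h3 : (Z ∩ D ∪ G.neighborFinset v ∩ Z).card ≤ Z.card :=
    card_le_card (union_subset inter_subset_left inter_subset_right)
  rw [card_union_of_disjoint] at h3
  · omega
  · rw [disjoint_left]
    intro x hx hx'
    rw [mem_inter, SimpleGraph.mem_neighborFinset] at hx'
    exact (hDv x (mem_inter.1 hx).2).2 hx'.1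

theorem card_exceptional_le :
    (insert v (G.neighborFinset v \ Z ∪ T)).card ≤
      (G.neighborFinset v \ Z).card + T.card + 1 :=
  (card_insert_le _ _).trans (by have := card_union_le (G.neighborFinset v \ Z) T; omega)

theorem adj_of_notMem_exceptional
    (hDadj : ∀ z ∈ D, ∀ x, x ∉ D → x ∉ T → x ≠ v → ¬ G.Adj v x → G.Adj z x) {z x : V}
    (hz : z ∈ D) (hxD : x ∉ D) (hxZ : x ∉ Z)
    (hx : x ∉ insert v (G.neighborFinset v \ Z ∪ T)) : G.Adj z x := by
  simp only [mem_insert, mem_union, mem_sdiff, SimpleGraph.mem_neighborFinset, not_or,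
    not_and, not_not] at hx
  exact hDadj z hz x hxD hx.2.2 hx.1 fun h => hxZ (hx.2.1 h)

/-- Outside `Z ∪ D`, members of `D` miss only `v`, `N(v) \ Z` and `T`. By `hT` and
`card_union_dominating`, `|T| ≤ |Z ∪ D| + |N(v) \ Z| - s - 1`, so at most `s + |Z ∪ D|` vertices are
missed. Pairs meeting `D` then have enough common neighbours because the order is at least `5s + 5`.
-/
theorem IsLinked.union (hZ : IsLinked G s Z) (hN : 2 * m + s + 1 ≤ Fintype.card V)
    (hN5 : 5 * s + 5 ≤ Fintype.card V) (hv : (G.neighborFinset v \ Z).card + Z.card ≤ s)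
    (hDv : ∀ x ∈ D, x ≠ v ∧ ¬ G.Adj v x)
    (hT : T.card + Fintype.card V ≤ D.card + (G.neighborFinset v).card + 2 * m)
    (hDadj : ∀ z ∈ D, ∀ x, x ∉ D → x ∉ T → x ≠ v → ¬ G.Adj v x → G.Adj z x)
    (hle : (Z ∪ D).card ≤ s) : IsLinked G s (Z ∪ D) := by
  have hcard := card_union_dominating (Z := Z) hDv
  have hZle : Z.card ≤ (Z ∪ D).card := card_le_card subset_union_left
  set R := insert v (G.neighborFinset v \ Z ∪ T) with hR
  have hRcard : R.card ≤ (G.neighborFinset v \ Z).card + T.card + 1 := card_exceptional_le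
  have hnew : ∀ z ∈ D, ∀ x, x ∉ Z ∪ D → x ∉ R → G.Adj z x := fun z hz x hx hxR => by
    rw [mem_union, not_or] at hx
    exact adj_of_notMem_exceptional hDadj hz hx.2 hx.1 hxR
  have hold : ∀ z ∈ Z, ∀ x, x ∉ Z ∪ D → x ∉ ({x | x ∉ Z ∧ ¬ G.Adj z x} : Finset V) →
      G.Adj z x := fun z hz x hx hxR => by
    rw [mem_union, not_or] at hx
    by_contra h
    exact hxR (mem_filter.2 ⟨mem_univ _, hx.1, h⟩)
  have hmixed : ∀ z ∈ Z, ∀ z' ∈ D, 2 * s + 3 ≤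
      ({x | x ∉ Z ∪ D ∧ G.Adj z x ∧ G.Adj z' x} : Finset V).card + (Z ∪ D).card := by
    intro z hz z' hz'
    have h1 := card_le_common_add (G := G) (Z := Z ∪ D) (a := z) (b := z')
      (R := ({x | x ∉ Z ∧ ¬ G.Adj z x} : Finset V) ∪ R) (fun x hx hxR => by
        rw [mem_union, not_or] at hxR
        exact ⟨hold z hz x hx hxR.1, hnew z' hz' x hx hxR.2⟩)
    have h2 := card_union_le ({x | x ∉ Z ∧ ¬ G.Adj z x} : Finset V) R
    have h3 := hZ.nonadj z hz
    omega
  constructor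
  · intro z hz
    by_cases hzZ : z ∈ Z
    · refine (card_le_card ?_).trans ((hZ.nonadj z hzZ).trans (by omega))
      intro x hx
      simp only [mem_filter, mem_univ, true_and, mem_union, not_or] at hx ⊢
      exact ⟨hx.1.1, hx.2⟩
    · have hzD : z ∈ D := (mem_union.1 hz).resolve_left hzZ
      have hsub : ({x | x ∉ Z ∪ D ∧ ¬ G.Adj z x} : Finset V) ⊆ R := by
        intro x hx
        rw [mem_filter] at hx
        by_contra hxR
        exact hx.2.2 (hnew z hzD x hx.2.1 hxR)
      have := card_le_card hsub
      omega
  · intro z hz z' hz'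
    rcases mem_union.1 hz with hz | hz <;> rcases mem_union.1 hz' with hz' | hz'
    · have hsub : ({x | x ∉ Z ∧ G.Adj z x ∧ G.Adj z' x} : Finset V) ⊆
          ({x | x ∉ Z ∪ D ∧ G.Adj z x ∧ G.Adj z' x} : Finset V) ∪ ((Z ∪ D) \ Z) := by
        intro x hx
        rw [mem_filter] at hx
        by_cases hxD : x ∈ Z ∪ D
        · exact mem_union_right _ (mem_sdiff.2 ⟨hxD, hx.2.1⟩)
        · exact mem_union_left _ (mem_filter.2 ⟨mem_univ _, hxD, hx.2.2⟩)
      have h1 := (card_le_card hsub).trans (card_union_le _ _)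
      have h2 := card_sdiff_add_card_eq_card (subset_union_left (s₁ := Z) (s₂ := D))
      have h3 := hZ.common z hz z' hz'
      omega
    · exact hmixed z hz z' hz'
    · have h := hmixed z' hz' z hz
      simpa only [and_comm] using h
    · have h1 := card_le_common_add (G := G) (Z := Z ∪ D) (a := z) (b := z') (R := R)
        (fun x hx hxR => ⟨hnew z hz x hx hxR, hnew z' hz' x hx hxR⟩)
      omega

/-- `Z ∪ D` is trimmed to a set `Y ⊇ Z` of exactly `s + 1` vertices. Members of `D` left outside `Y`
may be non-adjacent to those inside, so mixed pairs need `hDnon`; for two members of `D`, all of `D`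
is simply discarded. -/
theorem IsLinked.exists_path_of_union (hZ : IsLinked G s Z) (hN : 2 * m + s + 1 ≤ Fintype.card V)
    (hN5 : 5 * s + 5 ≤ Fintype.card V) (hv : (G.neighborFinset v \ Z).card + Z.card ≤ s)
    (hd : (G.neighborFinset v).card ≤ s) (hDs : D.card ≤ s)
    (hT : T.card + Fintype.card V ≤ D.card + (G.neighborFinset v).card + 2 * m)
    (hDadj : ∀ z ∈ D, ∀ x, x ∉ D → x ∉ T → x ≠ v → ¬ G.Adj v x → G.Adj z x)
    (hDnon : ∀ z ∈ D, ({x | x ≠ v ∧ ¬ G.Adj v x ∧ ¬ G.Adj z x} : Finset V).card +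
      Fintype.card V ≤ D.card + (G.neighborFinset v).card + 2 * m + 1)
    (hlt : s < (Z ∪ D).card) : ∃ l, IsPathList G l ∧ l.length = 2 * s + 3 := by
  obtain ⟨Y, hZY, hYD, hY⟩ := exists_subsuperset_card_eq
    (subset_union_left (s₁ := Z) (s₂ := D)) (n := s + 1) (by omega) (by omega)
  refine exists_path_of_common hY ?_
  have hnotZ : ∀ x, x ∉ Y → x ∉ Z := fun x hx h => hx (hZY h)
  have hmixed : ∀ z ∈ Z, ∀ z' ∈ D, s + 2 ≤
      ({x | x ∉ Y ∧ G.Adj z x ∧ G.Adj z' x} : Finset V).card := by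
    intro z hz z' hz'
    set P := insert v (G.neighborFinset v \ Z ∪
      ({x | x ≠ v ∧ ¬ G.Adj v x ∧ ¬ G.Adj z' x} : Finset V)) with hP
    have hPcard : P.card ≤ (G.neighborFinset v \ Z).card +
      ({x | x ≠ v ∧ ¬ G.Adj v x ∧ ¬ G.Adj z' x} : Finset V).card + 1 := card_exceptional_le
    have h1 := card_le_common_add (G := G) (Z := Y) (a := z) (b := z')
      (R := ({x | x ∉ Z ∧ ¬ G.Adj z x} : Finset V) ∪ P) (fun x hx hxR => by
        simp only [hP, mem_union, mem_insert, not_or, mem_filter, mem_univ, true_and, not_and,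
          not_not, mem_sdiff, SimpleGraph.mem_neighborFinset] at hxR
        obtain ⟨h1, h2, h3, h4⟩ := hxR
        exact ⟨h1 (hnotZ x hx), h4 h2 fun h => hnotZ x hx (h3 h)⟩)
    have h2 := card_union_le ({x | x ∉ Z ∧ ¬ G.Adj z x} : Finset V) P
    have h3 := hZ.nonadj z hz
    have h4 := hDnon z' hz'
    omega
  intro z hz z' hz'
  rcases mem_union.1 (hYD hz) with hz | hz <;> rcases mem_union.1 (hYD hz') with hz' | hz'
  · have hsub : ({x | x ∉ Z ∧ G.Adj z x ∧ G.Adj z' x} : Finset V) ⊆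
        ({x | x ∉ Y ∧ G.Adj z x ∧ G.Adj z' x} : Finset V) ∪ (Y \ Z) := by
      intro x hx
      rw [mem_filter] at hx
      by_cases hxY : x ∈ Y
      · exact mem_union_right _ (mem_sdiff.2 ⟨hxY, hx.2.1⟩)
      · exact mem_union_left _ (mem_filter.2 ⟨mem_univ _, hxY, hx.2.2⟩)
    have h1 := (card_le_card hsub).trans (card_union_le _ _)
    have h2 := card_sdiff_add_card_eq_card hZY
    have h3 := hZ.common z hz z' hz'
    omega
  · exact hmixed z hz z' hz'
  · have h := hmixed z' hz' z hz
    simpa only [and_comm] using h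
  · have h1 := card_le_common_add (G := G) (Z := Y) (a := z) (b := z')
      (R := D ∪ insert v (G.neighborFinset v \ Z ∪ T)) (fun x hx hxR => by
        rw [mem_union, not_or] at hxR
        exact ⟨adj_of_notMem_exceptional hDadj hz hxR.1 (hnotZ x hx) hxR.2,
          adj_of_notMem_exceptional hDadj hz' hxR.1 (hnotZ x hx) hxR.2⟩)
    have h2 := card_union_le D (insert v (G.neighborFinset v \ Z ∪ T))
    have h3 : (insert v (G.neighborFinset v \ Z ∪ T)).card ≤ _ := card_exceptional_le
    omega

end Extend

/-- A linked set and a vertex set of large minimum degree outside it give a long path. -/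
theorem IsLinked.exists_path_of_degree [Fintype V] [DecidableEq V] [DecidableRel G.Adj] {s : ℕ}
    {Z C : Finset V} (hZ : IsLinked G s Z) (hne : Z.Nonempty) (hZs : Z.card ≤ s) (hZC : Z ⊆ C)
    (hclosed : ∀ x ∈ C, ∀ y, G.Adj x y → y ∈ C)
    (hdeg : ∀ x ∈ C, s < (G.neighborFinset x \ Z).card + Z.card) :
    ∃ l, IsPathList G l ∧ l.length = 2 * s + 3 := by
  obtain ⟨z₁, h₁, z₂, h₂, heq⟩ := exists_ends hne
  have hpos := card_pos.2 hne
  -- With `e = s - |Z|`, the arms have `2e + 4` vertices; `|Z|` members and `|Z| - 1` connectors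
  -- bring the total to `2s + 3`.
  obtain ⟨e, he⟩ := Nat.exists_eq_add_of_le hZs
  obtain ⟨A, B, hA, hB, hAB, ⟨a, haU, haA⟩, ⟨b, hbU, hbB⟩, hlen, hAH, hBH⟩ :=
    exists_two_arms (G := G) (e := e) (H := C \ Z)
      (U := {x | x ∉ Z ∧ G.Adj z₁ x ∧ G.Adj z₂ x}) (by
        intro x hx
        rw [mem_filter] at hx
        exact mem_sdiff.2 ⟨hclosed z₁ (hZC h₁) x hx.2.2.1, hx.2.1⟩)
      (by have := hZ.common z₁ h₁ z₂ h₂; omega)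
      (fun x hx => by
        rw [mem_sdiff] at hx
        have h1 := hdeg x hx.1
        have h2 : (G.neighborFinset x \ Z).card ≤ {y ∈ C \ Z | G.Adj x y}.card := by
          refine card_le_card fun y hy => ?_
          rw [mem_sdiff, SimpleGraph.mem_neighborFinset] at hy
          exact mem_filter.2 ⟨mem_sdiff.2 ⟨hclosed x hx.1 y hy.1, hy.2⟩, hy.1⟩
        omega)
  rw [mem_filter] at haU hbU
  obtain ⟨l, hl, hl'⟩ := exists_path_through h₁ h₂ heq hA hB hAB
    (fun x hx => (mem_sdiff.1 (hAH x hx)).2) (fun x hx => (mem_sdiff.1 (hBH x hx)).2)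
    (fun x hx => by cases Option.mem_unique hx haA; exact haU.2.2.1)
    (fun x hx => by cases Option.mem_unique hx hbB; exact hbU.2.2.2)
    (fun z hz z' hz' => ⟨({x | x ∉ Z ∧ G.Adj z x ∧ G.Adj z' x} : Finset V), by
      have := hZ.common z hz z' hz'
      omega, fun q hq => by
      rw [mem_filter] at hq
      exact ⟨hq.2.2.1, hq.2.2.2, hq.2.1⟩⟩)
  exact ⟨l, hl, by omega⟩

/-- Take a largest linked `Z ⊆ C` with at most `s` vertices. A vertex with at most `s - |Z|`
neighbours outside `Z` yields a set `D` for which `Z ∪ D` either gives a path or is a larger linked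
set. Without such a vertex, the arms apply, or Dirac's argument when `Z` is empty. -/
theorem exists_path_of_large_component [Fintype V] [LinearOrder V] [DecidableRel G.Adj]
    {n m s : ℕ} (hs : 2 * s + 2 ≤ n) (hs' : n ≤ 2 * s + 3) (hnm : n ≤ m)
    (hfan : ¬ (fanGraph m).IsContained Gᶜ) (hN : 2 * m + s + 1 ≤ Fintype.card V)
    {C : Finset V} (hC : n ≤ C.card) (hclosed : ∀ x ∈ C, ∀ y, G.Adj x y → y ∈ C)
    (hconn : ∀ Y ⊆ C, Y.Nonempty → (∀ y ∈ Y, ∀ x ∈ C, G.Adj y x → x ∈ Y) → C ⊆ Y) :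
    ∃ l, IsPathList G l ∧ n ≤ l.length := by
  classical
  by_contra! hpath
  obtain ⟨Z, hZ, hmax⟩ := exists_max_image
    ((univ : Finset (Finset V)).filter fun Z => Z ⊆ C ∧ Z.card ≤ s ∧ IsLinked G s Z) card
    ⟨∅, mem_filter.2 ⟨mem_univ _, empty_subset _, by simp, ⟨by simp, by simp⟩⟩⟩
  rw [mem_filter] at hZ
  obtain ⟨-, hZC, hZs, hZ⟩ := hZ
  have hdeg : ∀ x ∈ C, s < (G.neighborFinset x \ Z).card + Z.card := by
    intro v hvC
    by_contra! hv
    have hd : (G.neighborFinset v).card ≤ s := by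
      have h1 := card_sdiff_add_card_inter (G.neighborFinset v) Z
      have h2 : (G.neighborFinset v ∩ Z).card ≤ Z.card := card_le_card inter_subset_right
      omega
    obtain ⟨D, T, hDv, hDs, hT, hDadj, hDnon, hDT, hDC⟩ :=
      exists_dominating_set hs hs' hpath hfan hN hd (by omega)
    by_cases hlt : s < (Z ∪ D).card
    · obtain ⟨l, hl, hlen⟩ := hZ.exists_path_of_union hN (by omega) hv hd hDs hT hDadj hDnon hlt
      have := hpath l hl
      omega
    · have hlink := hZ.union hN (by omega) hv hDv hT hDadj (by omega)
      have h1 := hmax (Z ∪ D) (mem_filter.2 ⟨mem_univ _, union_subset hZC fun x hx =>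
        hDC C hC hclosed x (hDT x hx) (hDv x hx).1 (hDv x hx).2, by omega, hlink⟩)
      have h2 := card_union_dominating (Z := Z) hDv
      omega
  rcases Z.eq_empty_or_nonempty with rfl | hne
  · obtain ⟨l, hl, hlen⟩ := exists_long_path_of_degree (G := G) hs' hC (by omega) hconn
      (fun x hx => by
        have h1 := hdeg x hx
        rw [sdiff_empty, card_empty, add_zero] at h1
        refine Nat.lt_of_lt_of_le h1 (card_le_card fun y hy => ?_)
        rw [SimpleGraph.mem_neighborFinset] at hy
        exact mem_filter.2 ⟨hclosed x hx y hy, hy⟩)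
    have := hpath l hl
    omega
  · obtain ⟨l, hl, hlen⟩ := hZ.exists_path_of_degree hne hZs hZC hclosed hdeg
    have := hpath l hl
    omega

end Linked

/-! ### The case `m < n`, large components, and the upper bound. -/

section Upper

variable {V : Type} {G : SimpleGraph V}

/-- For a vertex `v` of degree at most `s`, the bounds on `D` and `T` are tight: `n = 2s + 2`, `|D|
= deg v = s` and `T = ∅`. Alternation through `D` gives only `2s + 1` vertices; the missing one
comes from an edge outside `D` attached at one end. -/
theorem exists_path_of_component_of_lt [Fintype V] [LinearOrder V] [DecidableRel G.Adj]
    {n m s : ℕ} (hs : 2 * s + 2 ≤ n) (hs' : n ≤ 2 * s + 3) (hmn : m < n)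
    (hfan : ¬ (fanGraph m).IsContained Gᶜ) (hN : 2 * m + s + 1 ≤ Fintype.card V)
    (hN₁ : 2 * n ≤ Fintype.card V + 1) (hN₂ : 2 * m + n ≤ Fintype.card V + 2)
    {C : Finset V} (hC : n ≤ C.card) (hclosed : ∀ x ∈ C, ∀ y, G.Adj x y → y ∈ C)
    (hconn : ∀ Y ⊆ C, Y.Nonempty → (∀ y ∈ Y, ∀ x ∈ C, G.Adj y x → x ∈ Y) → C ⊆ Y) :
    ∃ l, IsPathList G l ∧ n ≤ l.length := by
  by_contra! hpath
  obtain ⟨v, hvC, hd⟩ : ∃ v ∈ C, (G.neighborFinset v).card ≤ s := by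
    by_contra! hdeg
    obtain ⟨l, hl, hlen⟩ := exists_long_path_of_degree (G := G) hs' hC (by omega) hconn
      (fun x hx => by
        refine Nat.lt_of_lt_of_le (hdeg x hx) (card_le_card fun y hy => ?_)
        rw [SimpleGraph.mem_neighborFinset] at hy
        exact mem_filter.2 ⟨hclosed x hx y hy, hy⟩)
    have := hpath l hl
    omega
  obtain ⟨D, T, hDv, hDs, hT, hDadj, -, -, -⟩ :=
    exists_dominating_set hs hs' hpath hfan hN hd (by omega)
  have hDcard : D.card = s := by omega
  have hT0 : T = ∅ := card_eq_zero.1 (by omega)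
  subst hT0
  have hDadj' : ∀ z ∈ D, ∀ x, x ∉ D → x ≠ v → ¬ G.Adj v x → G.Adj z x :=
    fun z hz x hx => hDadj z hz x hx (by simp)
  have hDne : D.Nonempty := card_pos.1 (by omega)
  -- `C` is larger than the closed neighbourhood of `v`, so by connectivity some non-neighbour of
  -- `v` is joined to a neighbour.
  obtain ⟨y, x, hyv, hvy, hvx, hyx⟩ : ∃ y x, y ≠ v ∧ ¬ G.Adj v y ∧ G.Adj v x ∧ G.Adj y x := by
    by_contra! hcon
    have hCY := hconn {x ∈ C | x ≠ v ∧ ¬ G.Adj v x} (filter_subset _ _) (by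
      obtain ⟨w, hwC, hw⟩ := exists_mem_notMem_of_card_lt_card
        (show (insert v (G.neighborFinset v)).card < C.card by
          have := card_insert_le v (G.neighborFinset v)
          omega)
      rw [mem_insert, SimpleGraph.mem_neighborFinset, not_or] at hw
      exact ⟨w, mem_filter.2 ⟨hwC, hw⟩⟩) (by
      intro y hy x hx hyx
      rw [mem_filter] at hy ⊢
      refine ⟨hx, ?_, fun h => hcon y x hy.2.1 hy.2.2 h hyx⟩
      rintro rfl
      exact hy.2.2 hyx.symm)
    exact (mem_filter.1 (hCY hvC)).2.1 rfl
  have hcommon : ∀ z ∈ D, ∀ z' ∈ D,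
      2 * s + 2 ≤ ({x | x ∉ D ∧ G.Adj z x ∧ G.Adj z' x} : Finset V).card := by
    intro z hz z' hz'
    have h1 := card_le_common_add (G := G) (Z := D) (a := z) (b := z')
      (R := insert v (G.neighborFinset v)) (fun x hx hxR => by
        rw [mem_insert, SimpleGraph.mem_neighborFinset, not_or] at hxR
        exact ⟨hDadj' z hz x hx hxR.1 hxR.2, hDadj' z' hz' x hx hxR.1 hxR.2⟩)
    have h2 := card_insert_le v (G.neighborFinset v)
    omega
  -- The extra edge is `xv`, attached at `y`, if `y ∈ D`; otherwise it is `yx`.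
  obtain ⟨z₁, h₁, z₂, h₂, heq, a, a', haa', haD, haD', hz₁a⟩ : ∃ z₁ ∈ D, ∃ z₂ ∈ D,
      (z₁ = z₂ → D = {z₁}) ∧ ∃ a a', G.Adj a a' ∧ a ∉ D ∧ a' ∉ D ∧ G.Adj z₁ a := by
    have hxD : x ∉ D := fun h => (hDv x h).2 hvx
    by_cases hyD : y ∈ D
    · have hvD : v ∉ D := fun h => (hDv v h).1 rfl
      by_cases hother : ∃ z ∈ D, y ≠ z
      · obtain ⟨z, hz, hyz⟩ := hother
        exact ⟨y, hyD, z, hz, fun h => absurd h hyz, x, v, hvx.symm, hxD, hvD, hyx⟩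
      · push Not at hother
        exact ⟨y, hyD, y, hyD, fun _ => eq_singleton_iff_unique_mem.2
          ⟨hyD, fun z hz => (hother z hz).symm⟩, x, v, hvx.symm, hxD, hvD, hyx⟩
    · obtain ⟨z₁, h₁, z₂, h₂, heq⟩ := exists_ends hDne
      exact ⟨z₁, h₁, z₂, h₂, heq, y, x, hyx, hyD, hxD, hDadj' z₁ h₁ y hyD hyv hvy⟩
  obtain ⟨b, hb, hbaa'⟩ := exists_mem_notMem_of_card_lt_card
    (show ({a, a'} : Finset V).card <
        ({x | x ∉ D ∧ G.Adj z₁ x ∧ G.Adj z₂ x} : Finset V).card by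
      have h1 := card_le_two (a := a) (b := a')
      have h2 := hcommon z₁ h₁ z₂ h₂
      have h3 := card_pos.2 hDne
      omega)
  rw [mem_insert, mem_singleton, not_or] at hbaa'
  rw [mem_filter] at hb
  obtain ⟨l, hl, hlen⟩ := exists_path_through (G := G) h₁ h₂ heq (A := [a, a']) (B := [b])
    ((isPathList_singleton a').cons (by simpa using haa'.ne) (by simpa using haa'))
    (isPathList_singleton b) (by simpa using ⟨Ne.symm hbaa'.1, Ne.symm hbaa'.2⟩)
    (by simpa using ⟨haD, haD'⟩) (by simpa using hb.2.1) (by simpa using hz₁a)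
    (by simpa using hb.2.2.2)
    (fun z hz z' hz' => ⟨({x | x ∉ D ∧ G.Adj z x ∧ G.Adj z' x} : Finset V), by
      have := hcommon z hz z' hz'
      simp only [List.length_cons, List.length_nil]
      omega, fun q hq => by
      rw [mem_filter] at hq
      exact ⟨hq.2.2.1, hq.2.2.2, hq.2.1⟩⟩)
  have := hpath l hl
  simp only [List.length_cons, List.length_nil] at hlen
  omega

/-- The number of vertices forces a fan in the complement when all components are small. -/
theorem exists_large_component [Fintype V] [LinearOrder V] {n m : ℕ}
    (hfan : ¬ (fanGraph m).IsContained Gᶜ) (hpos : 0 < Fintype.card V)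
    (hnum : (n ≤ m ∧ ∀ j c, Fintype.card V ≤ j * (n - 1) → j * c ≤ Fintype.card V →
        2 * m + c ≤ Fintype.card V) ∨
      (m < n ∧ 2 * n ≤ Fintype.card V + 1 ∧ 2 * m + n ≤ Fintype.card V + 2)) :
    ∃ C : Finset V, n ≤ C.card ∧ (∀ x ∈ C, ∀ y, G.Adj x y → y ∈ C) ∧
      ∀ Y ⊆ C, Y.Nonempty → (∀ y ∈ Y, ∀ x ∈ C, G.Adj y x → x ∈ Y) → C ⊆ Y := by
  classical
  let cl : G.ConnectedComponent → Finset V := fun κ => {x | G.connectedComponentMk x = κ}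
  have hmem : ∀ x κ, x ∈ cl κ ↔ G.connectedComponentMk x = κ := fun x κ => by simp [cl]
  have hclosed : ∀ κ, ∀ x ∈ cl κ, ∀ y, G.Adj x y → y ∈ cl κ := by
    intro κ x hx y hxy
    rw [hmem] at hx ⊢
    rw [← hx, SimpleGraph.ConnectedComponent.eq]
    exact hxy.symm.reachable
  by_cases hbig : ∃ κ, n ≤ (cl κ).card
  · obtain ⟨κ, hκ⟩ := hbig
    refine ⟨cl κ, hκ, hclosed κ, ?_⟩
    rintro Y hY ⟨y, hy⟩ hYc x hx
    have hyκ := hY hy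
    rw [hmem] at hyκ hx
    have hreach : G.Reachable y x := by
      rw [← SimpleGraph.ConnectedComponent.eq, hyκ, hx]
    obtain ⟨p⟩ := hreach
    clear hyκ hx
    induction p with
    | nil => exact hy
    | cons h p ih => exact ih (hYc _ hy _ (hclosed κ _ (hY hy) _ h) h)
  exfalso
  push Not at hbig
  let _ : Fintype G.ConnectedComponent := Fintype.ofFinite _
  have hsum : Fintype.card V = ∑ κ, (cl κ).card := by
    rw [← card_univ]
    exact card_eq_sum_card_fiberwise (f := G.connectedComponentMk) (t := univ) (by simp)
  obtain ⟨v₀⟩ := Fintype.card_pos_iff.1 hpos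
  obtain ⟨κ₀, -, hmin⟩ := exists_min_image (univ : Finset G.ConnectedComponent)
    (fun κ => (cl κ).card) ⟨G.connectedComponentMk v₀, mem_univ _⟩
  have hupper : Fintype.card V ≤ Fintype.card G.ConnectedComponent * (n - 1) := by
    rw [hsum, ← card_univ, ← smul_eq_mul]
    exact sum_le_card_nsmul _ _ _ fun κ _ => by have := hbig κ; omega
  have hlower : Fintype.card G.ConnectedComponent * (cl κ₀).card ≤ Fintype.card V := by
    rw [hsum, ← card_univ, ← smul_eq_mul]
    exact card_nsmul_le_sum _ _ _ fun κ _ => hmin κ (mem_univ κ)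
  obtain ⟨hfit, hothers⟩ : 2 * m + (cl κ₀).card ≤ Fintype.card V ∧
      ∀ κ, κ ≠ κ₀ → (cl κ).card + (cl κ₀).card + m ≤ Fintype.card V := by
    rcases hnum with ⟨hnm, hnum⟩ | ⟨hmn, h₁, h₂⟩
    · have := hnum _ _ hupper hlower
      exact ⟨this, fun κ _ => by have := hbig κ; omega⟩
    -- Two components of order below `n` cannot hold `2n - 1` vertices.
    · have h3 : 3 ≤ Fintype.card G.ConnectedComponent := by
        by_contra! hlt
        have : Fintype.card G.ConnectedComponent * (n - 1) ≤ 2 * (n - 1) :=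
          Nat.mul_le_mul_right _ (by omega)
        omega
      have h4 : 3 * (cl κ₀).card ≤ Fintype.card V := (Nat.mul_le_mul_right _ h3).trans hlower
      refine ⟨by omega, fun κ hκ => ?_⟩
      obtain ⟨κ', -, hκ'⟩ := exists_mem_notMem_of_card_lt_card
        (show ({κ, κ₀} : Finset G.ConnectedComponent).card <
            (univ : Finset G.ConnectedComponent).card by
          have := card_le_two (a := κ) (b := κ₀)
          rw [card_univ]
          omega)
      have h5 : ∑ κ ∈ ({κ', κ, κ₀} : Finset G.ConnectedComponent), (cl κ).card ≤
          Fintype.card V := by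
        rw [hsum]
        exact sum_le_sum_of_subset (subset_univ _)
      rw [sum_insert hκ', sum_pair hκ] at h5
      have h6 := hmin κ' (mem_univ _)
      have h7 := hbig κ
      omega
  obtain ⟨v, hv⟩ := κ₀.exists_rep
  have hv' : v ∈ cl κ₀ := (hmem _ _).2 hv
  have hScard := card_compl_add_card (cl κ₀)
  obtain ⟨ι, _, c, T, hTS, hX, hp⟩ := exists_multipartite_of_not_fan hfan (v := v)
    (S := (cl κ₀)ᶜ) (fun x hx => by
      rw [mem_compl] at hx
      exact ⟨fun h => hx (h ▸ hv'), fun h => hx (hclosed _ _ hv' _ h)⟩) (by omega)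
  set X := (cl κ₀)ᶜ \ T with hXdef
  have hXT : X.card + T.card = ((cl κ₀)ᶜ).card := card_sdiff_add_card_eq_card hTS
  have hpX : (X.image c).card ≤ X.card := card_image_le
  -- Two classes make `X` connected, so it lies in one component other than `κ₀`. But `|T| ≤ m - 1`
  -- makes `X` too large for that component.
  obtain ⟨i, hi, k, hk, hik⟩ := one_lt_card.1 (show 1 < (X.image c).card by omega)
  obtain ⟨x₁, hx₁, rfl⟩ := mem_image.1 hi
  obtain ⟨x₂, hx₂, rfl⟩ := mem_image.1 hk
  have hsub := mem_of_multipartite hX (Y := cl (G.connectedComponentMk x₁)) (fun x _ => by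
    by_cases h : c x = c x₁
    · exact ⟨x₂, hx₂, by rw [h]; exact hik.symm⟩
    · exact ⟨x₁, hx₁, Ne.symm h⟩) (fun y hy x _ => hclosed _ y hy x) hx₁ ((hmem _ _).2 rfl)
  have h1 := card_le_card hsub
  have h2 := hothers (G.connectedComponentMk x₁) (fun h => by
    have := (mem_sdiff.1 hx₁).1
    rw [mem_compl, hmem] at this
    exact this h)
  omega

/-- The upper bound for the path-fan Ramsey number. -/
theorem pathGraph_or_fanGraph_isContained {n m r : ℕ} (hn : 2 ≤ n)
    (hnum : (n ≤ m ∧ 2 * m + n / 2 ≤ r ∧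
        ∀ j c, r ≤ j * (n - 1) → j * c ≤ r → 2 * m + c ≤ r) ∨
      (m < n ∧ 2 * n ≤ r + 1 ∧ 2 * m + n ≤ r + 2)) (G : SimpleGraph (Fin r)) :
    (SimpleGraph.pathGraph n).IsContained G ∨ (fanGraph m).IsContained Gᶜ := by
  classical
  by_contra hcon
  rw [not_or] at hcon
  obtain ⟨hpath, hfan⟩ := hcon
  have hr : Fintype.card (Fin r) = r := Fintype.card_fin r
  obtain ⟨C, hC, hclosed, hconn⟩ := exists_large_component (n := n) hfan (by omega) (by
    rw [hr]
    rcases hnum with h | h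
    · exact Or.inl ⟨h.1, h.2.2⟩
    · exact Or.inr h)
  obtain ⟨l, hl, hlen⟩ : ∃ l, IsPathList G l ∧ n ≤ l.length := by
    rcases hnum with ⟨h1, h2, -⟩ | ⟨h1, h2, h3⟩
    · exact exists_path_of_large_component (s := n / 2 - 1) (by omega) (by omega) h1 hfan
        (by omega) hC hclosed hconn
    · exact exists_path_of_component_of_lt (s := n / 2 - 1) (by omega) (by omega) h1 hfan
        (by omega) (by omega) (by omega) hC hclosed hconn
  have := hl.length_lt_of_not_isContained hpath
  omega

end Upper

/-! ### Extremal examples: disjoint unions of cliques. -/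

section Lower

/-- The disjoint union of cliques on the colour classes of `c`. -/
def clusterGraph {V ι : Type*} (c : V → ι) : SimpleGraph V where
  Adj x y := x ≠ y ∧ c x = c y
  symm := ⟨fun _ _ h => ⟨h.1.symm, h.2.symm⟩⟩
  loopless := ⟨fun _ h => h.1 rfl⟩

theorem compl_clusterGraph_adj {V ι : Type*} {c : V → ι} {x y : V} :
    (clusterGraph c)ᶜ.Adj x y ↔ c x ≠ c y := by
  rw [SimpleGraph.compl_adj]
  refine ⟨fun h h' => h.2 ⟨h.1, h'⟩, fun h => ⟨fun h' => h (congrArg c h'), fun h' => h h'.2⟩⟩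

variable {V ι : Type*} [Fintype V] [DecidableEq ι] {c : V → ι}

theorem not_pathGraph_isContained_clusterGraph {n : ℕ} (hn : 0 < n)
    (hc : ∀ i, ({x | c x = i} : Finset V).card < n) :
    ¬ (SimpleGraph.pathGraph n).IsContained (clusterGraph c) := by
  rintro ⟨φ⟩
  have hcol : ∀ k (hk : k < n), c (φ ⟨k, hk⟩) = c (φ ⟨0, hn⟩) := by
    intro k
    induction k with
    | zero => exact fun _ => rfl
    | succ k ih =>
      intro hk
      have hadj : (SimpleGraph.pathGraph n).Adj ⟨k, by omega⟩ ⟨k + 1, hk⟩ := by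
        rw [SimpleGraph.pathGraph_adj]
        exact Or.inl rfl
      have := φ.toHom.map_adj hadj
      exact this.2.symm.trans (ih (by omega))
  have hle : (univ : Finset (Fin n)).card ≤ ({x | c x = c (φ ⟨0, hn⟩)} : Finset V).card :=
    card_le_card_of_injOn φ (fun k _ => by simpa using hcol k.1 k.2) φ.injective.injOn
  have := hc (c (φ ⟨0, hn⟩))
  rw [card_univ, Fintype.card_fin] at hle
  omega

theorem not_fanGraph_isContained_of_card_lt {m : ℕ}
    (hc : ∀ v, ({x | c x ≠ c v} : Finset V).card < 2 * m) :
    ¬ (fanGraph m).IsContained (clusterGraph c)ᶜ := by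
  rintro ⟨φ⟩
  have hle : (univ : Finset (Fin m × Fin 2)).card ≤
      ({x | c x ≠ c (φ (Sum.inl 0))} : Finset V).card := by
    refine card_le_card_of_injOn (fun p => φ (Sum.inr p)) (fun p _ => ?_)
      (φ.injective.comp Sum.inr_injective).injOn
    have hadj : (fanGraph m).Adj (Sum.inr p) (Sum.inl 0) := trivial
    have := compl_clusterGraph_adj.1 (φ.toHom.map_adj hadj)
    simpa using this
  have := hc (φ (Sum.inl 0))
  rw [card_univ, Fintype.card_prod, Fintype.card_fin, Fintype.card_fin] at hle
  omega

/-- Each rim edge has an end outside the class `i`, so a fan needs `m` vertices outside both `i` and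
the class of its hub. -/
theorem not_fanGraph_isContained_of_two_classes {m : ℕ}
    (hc : ∀ v, ∃ i, ({x | c x ≠ c v ∧ c x ≠ i} : Finset V).card < m) :
    ¬ (fanGraph m).IsContained (clusterGraph c)ᶜ := by
  rintro ⟨φ⟩
  obtain ⟨i, hi⟩ := hc (φ (Sum.inl 0))
  have hex : ∀ k : Fin m, ∃ b : Fin 2, c (φ (Sum.inr (k, b))) ≠ i := by
    intro k
    by_contra! h
    have hadj : (fanGraph m).Adj (Sum.inr (k, 0)) (Sum.inr (k, 1)) := ⟨rfl, zero_ne_one⟩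
    have := compl_clusterGraph_adj.1 (φ.toHom.map_adj hadj)
    exact this ((h 0).trans (h 1).symm)
  choose b hb using hex
  have hle : (univ : Finset (Fin m)).card ≤
      ({x | c x ≠ c (φ (Sum.inl 0)) ∧ c x ≠ i} : Finset V).card := by
    refine card_le_card_of_injOn (fun k => φ (Sum.inr (k, b k))) (fun k _ => ?_) ?_
    · have hadj : (fanGraph m).Adj (Sum.inr (k, b k)) (Sum.inl 0) := trivial
      have := compl_clusterGraph_adj.1 (φ.toHom.map_adj hadj)
      simpa using ⟨this, hb k⟩
    · intro k _ k' _ h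
      exact congrArg Prod.fst (Sum.inr_injective (φ.injective h))
  rw [card_univ, Fintype.card_fin] at hle
  omega

/-- One example on `r - 1` vertices suffices, since its induced subgraphs handle all smaller orders.
-/
theorem isRamseyNumber_of_example {A B : Type*} {G₁ : SimpleGraph A} {G₂ : SimpleGraph B} {r N : ℕ}
    (hr : r = N + 1)
    (hup : ∀ G : SimpleGraph (Fin r), G₁.IsContained G ∨ G₂.IsContained Gᶜ)
    (H : SimpleGraph (Fin N)) (h₁ : ¬ G₁.IsContained H) (h₂ : ¬ G₂.IsContained Hᶜ) :
    IsRamseyNumber G₁ G₂ r := by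
  refine ⟨hup, fun r' hr' => ?_⟩
  by_contra! hlt
  have hle : r' ≤ N := by omega
  have hinj := Fin.castLE_injective hle
  rcases hr' (H.comap (Fin.castLE hle)) with h | h
  · exact h₁ (h.trans ⟨⟨⟨Fin.castLE hle, fun h => h⟩, hinj⟩⟩)
  · refine h₂ (h.trans ⟨⟨⟨Fin.castLE hle, fun {x y} h => ?_⟩, hinj⟩⟩)
    rw [SimpleGraph.compl_adj] at h ⊢
    exact ⟨fun h' => h.1 (hinj h'), h.2⟩

theorem card_filter_fin {N : ℕ} (p : ℕ → Prop) [DecidablePred p] :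
    ({x | p x.1} : Finset (Fin N)).card = ((range N).filter p).card := by
  rw [← card_map Fin.valEmbedding]
  congr 1
  ext x
  simp only [mem_map, mem_filter, mem_univ, true_and, Fin.valEmbedding_apply, mem_range]
  constructor
  · rintro ⟨y, hy, rfl⟩
    exact ⟨y.2, hy⟩
  · rintro ⟨hx, hp⟩
    exact ⟨⟨x, hx⟩, hp, rfl⟩

theorem card_residue_class {N j : ℕ} (hj : 0 < j) (i : ℕ) :
    ({x | x.1 % j = i % j} : Finset (Fin N)).card =
      N / j + if i % j < N % j then 1 else 0 := by
  rw [card_filter_fin (fun x => x % j = i % j), ← Nat.count_modEq_card N hj i,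
    Nat.count_eq_card_filter_range]
  rfl

/-- Residues modulo `j` give nearly equal cliques: `hup` keeps the largest below `n`, and `hlow`
makes each large enough that a vertex has fewer than `2m` non-neighbours. -/
theorem exists_residue_example {n m N j : ℕ} (hn : 0 < n) (hj : 0 < j) (hup : N ≤ j * (n - 1))
    (hlow : j * (N + 1 - 2 * m) ≤ N) :
    ∃ H : SimpleGraph (Fin N), ¬ (SimpleGraph.pathGraph n).IsContained H ∧
      ¬ (fanGraph m).IsContained Hᶜ := by
  refine ⟨clusterGraph fun x : Fin N => x.1 % j, not_pathGraph_isContained_clusterGraph hn ?_,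
    not_fanGraph_isContained_of_card_lt ?_⟩
  · intro i
    by_cases hi : i < j
    · have h := card_residue_class (N := N) hj i
      rw [Nat.mod_eq_of_lt hi] at h
      rw [h]
      have h1 := Nat.div_add_mod N j
      split_ifs with h2
      · have : N / j < n - 1 := by
          by_contra! hcon
          have := Nat.mul_le_mul_left j hcon
          omega
        omega
      · have : N / j ≤ n - 1 := Nat.div_le_of_le_mul hup
        omega
    · have h0 : ({x | x.1 % j = i} : Finset (Fin N)) = ∅ := by
        ext x
        have := Nat.mod_lt x.1 hj
        simp
        omega
      rw [h0, card_empty]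
      exact hn
  · intro v
    have h := card_residue_class (N := N) hj v.1
    have h1 := card_filter_add_card_filter_not (s := (univ : Finset (Fin N)))
      (fun x => x.1 % j = v.1 % j)
    rw [card_univ, Fintype.card_fin] at h1
    have h2 : N + 1 - 2 * m ≤ N / j := (Nat.le_div_iff_mul_le hj).2 (by rwa [mul_comm])
    have := v.2
    simp only [ne_eq]
    omega

/-- For a hub in the first clique the discarded class is the second; for any other hub it is the
first. A hub in the third clique forces `b' > 0`, hence `b < m`. -/
theorem exists_three_cliques_example {n m a b b' N : ℕ} (hN : N = a + b + b') (ha : a < n)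
    (hb : b < n) (hb' : b' < n) (hb'm : b' < m) (hbm : b < m ∨ b' = 0) :
    ∃ H : SimpleGraph (Fin N), ¬ (SimpleGraph.pathGraph n).IsContained H ∧
      ¬ (fanGraph m).IsContained Hᶜ := by
  subst hN
  let f : ℕ → Fin 3 := fun x => if x < a then 0 else if x < a + b then 1 else 2
  have hf0 : ∀ x, f x = 0 → x ∈ Ico 0 a := by
    intro x hx
    simp only [f] at hx
    split_ifs at hx <;> simp_all
  have hf1 : ∀ x, f x = 1 → x ∈ Ico a (a + b) := by
    intro x hx
    simp only [f] at hx
    split_ifs at hx <;> simp_all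
  have hf2 : ∀ x < a + b + b', f x = 2 → x ∈ Ico (a + b) (a + b + b') := by
    intro x hlt hx
    simp only [f] at hx
    split_ifs at hx <;> simp_all
  have hcard : ∀ (p : ℕ → Prop) [DecidablePred p] (u w : ℕ),
      (∀ x < a + b + b', p x → x ∈ Ico u w) →
      ({x | p x.1} : Finset (Fin (a + b + b'))).card ≤ w - u := by
    intro p _ u w h
    rw [card_filter_fin p, ← Nat.card_Ico]
    refine card_le_card fun x hx => ?_
    rw [mem_filter, mem_range] at hx
    exact h x hx.1 hx.2
  have hthree : ∀ i : Fin 3, i = 0 ∨ i = 1 ∨ i = 2 := by decide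
  refine ⟨clusterGraph fun x : Fin (a + b + b') => f x.1,
    not_pathGraph_isContained_clusterGraph (by omega) ?_,
    not_fanGraph_isContained_of_two_classes ?_⟩
  · intro i
    rcases hthree i with rfl | rfl | rfl
    · have := hcard (fun x => f x = 0) 0 a fun x _ => hf0 x
      omega
    · have := hcard (fun x => f x = 1) a (a + b) fun x _ => hf1 x
      omega
    · have := hcard (fun x => f x = 2) (a + b) (a + b + b') hf2
      omega
  · intro v
    rcases hthree (f v.1) with h | h | h
    · refine ⟨1, ?_⟩
      have := hcard (fun x => f x ≠ f v.1 ∧ f x ≠ 1) (a + b) (a + b + b') fun x hx hp =>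
        hf2 x hx (((hthree (f x)).resolve_left (h ▸ hp.1)).resolve_left hp.2)
      omega
    · refine ⟨0, ?_⟩
      have := hcard (fun x => f x ≠ f v.1 ∧ f x ≠ 0) (a + b) (a + b + b') fun x hx hp =>
        hf2 x hx (((hthree (f x)).resolve_left hp.2).resolve_left (h ▸ hp.1))
      omega
    · refine ⟨0, ?_⟩
      have hv := mem_Ico.1 (hf2 _ v.2 h)
      have := hcard (fun x => f x ≠ f v.1 ∧ f x ≠ 0) a (a + b) fun x _ hp =>
        hf1 x (((hthree (f x)).resolve_left hp.2).resolve_right (h ▸ hp.1))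
      omega

end Lower

/-! ### The arithmetic of `t(n, 2m)`. -/

section Arithmetic

theorem tBeta_bounds {n m : ℕ} (hn : 2 ≤ n) (hm : 1 ≤ m) :
    2 * m - 1 ≤ tBeta n (2 * m) * (n - 1) ∧
      tBeta n (2 * m) * (n - 1) < 2 * m - 1 + (n - 1) := by
  have hn1 : (0 : ℚ) < (n : ℚ) - 1 := by
    have : (2 : ℚ) ≤ n := by exact_mod_cast hn
    linarith
  have hm1 : (0 : ℚ) ≤ ((2 * m : ℕ) : ℚ) - 1 := by
    have : (1 : ℚ) ≤ ((2 * m : ℕ) : ℚ) := by exact_mod_cast (by omega : 1 ≤ 2 * m)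
    linarith
  have h1 : tAlpha n (2 * m) ≤ tBeta n (2 * m) := Nat.le_ceil _
  have h2 : (tBeta n (2 * m) : ℚ) < tAlpha n (2 * m) + 1 :=
    Nat.ceil_lt_add_one (div_nonneg hm1 hn1.le)
  have h3 : tAlpha n (2 * m) * ((n : ℚ) - 1) = ((2 * m : ℕ) : ℚ) - 1 :=
    div_mul_cancel₀ _ hn1.ne'
  have h4 := mul_le_mul_of_nonneg_right h1 hn1.le
  have h5 := mul_lt_mul_of_pos_right h2 hn1
  rw [add_mul, h3] at h5
  rw [h3] at h4
  constructor
  · zify [show 1 ≤ 2 * m by omega, show 1 ≤ n by omega]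
    exact_mod_cast h4
  · zify [show 1 ≤ 2 * m by omega, show 1 ≤ n by omega]
    rw [one_mul] at h5
    exact_mod_cast h5

theorem tAlpha_le_tGamma_iff {n m : ℕ} (hn : 2 ≤ n) (hm : 1 ≤ m) :
    tAlpha n (2 * m) ≤ tGamma n (2 * m) ↔
      (2 * m - 1) * (tBeta n (2 * m) + 1) ≤ tBeta n (2 * m) ^ 2 * (n - 1) := by
  have hn1 : (0 : ℚ) < (n : ℚ) - 1 := by
    have : (2 : ℚ) ≤ n := by exact_mod_cast hn
    linarith
  unfold tGamma tAlpha
  rw [div_le_div_iff₀ hn1 (by positivity)]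
  zify [show 1 ≤ 2 * m by omega, show 1 ≤ n by omega]
  exact_mod_cast Iff.rfl

/-- Here `j` counts components of order at most `n - 1` and `c` is the least order; put `K = 2m -
1`, `q = ⌊K/β⌋`. If `α ≤ γ`, the example is `β` cliques of order `n - 1`, and one more vertex forces
`j ≥ β + 1`, which makes `c` small. If `α > γ`, the example has `β + 1` cliques of order at least
`q`; on one more vertex `j ≤ β` components lack room, and `j ≥ β + 1` gives `c ≤ q`. -/
theorem tValue_spec {n m : ℕ} (hn : 2 ≤ n) (hnm : n ≤ m) :
    (∃ N j, tValue n (2 * m) = N + 1 ∧ 0 < j ∧ N ≤ j * (n - 1) ∧ j * (N + 1 - 2 * m) ≤ N) ∧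
      2 * m + n / 2 ≤ tValue n (2 * m) ∧
      ∀ j c, tValue n (2 * m) ≤ j * (n - 1) → j * c ≤ tValue n (2 * m) →
        2 * m + c ≤ tValue n (2 * m) := by
  obtain ⟨hlow, hup⟩ := tBeta_bounds hn (show 1 ≤ m by omega)
  have hiff := tAlpha_le_tGamma_iff hn (show 1 ≤ m by omega)
  have hval : tValue n (2 * m) = if tAlpha n (2 * m) ≤ tGamma n (2 * m) then
      (n - 1) * tBeta n (2 * m) + 1 else (2 * m - 1) / tBeta n (2 * m) + 2 * m := by
    unfold tValue
    congr 2
    rw [← Nat.floor_div_eq_div (K := ℚ), Nat.cast_sub (by omega), Nat.cast_one]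
  simp only [hiff] at hval
  rw [hval]
  clear hval hiff
  set β := tBeta n (2 * m)
  obtain ⟨g, rfl⟩ : ∃ g, n = g + 1 := ⟨n - 1, by omega⟩
  obtain ⟨K, hK⟩ : ∃ K, 2 * m = K + 1 := ⟨2 * m - 1, by omega⟩
  rw [hK] at hlow hup ⊢
  simp only [Nat.add_sub_cancel] at hlow hup ⊢
  have hβ : 0 < β := by
    rcases Nat.eq_zero_or_pos β with h | h
    · rw [h] at hlow; omega
    · exact h
  have hhalf : 2 * ((g + 1) / 2) ≤ g + 1 := Nat.mul_div_le _ _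
  have hhalf' : 1 ≤ (g + 1) / 2 := by omega
  set h := (g + 1) / 2
  split_ifs with hc
  · refine ⟨⟨g * β, β, rfl, hβ, by rw [mul_comm], ?_⟩, ?_, ?_⟩
    · rw [mul_comm g β]
      exact Nat.mul_le_mul_left _ (by omega)
    · by_contra! hcon
      nlinarith
    · intro j c h1 h2
      have hj : β + 1 ≤ j := by
        by_contra! hj
        have := Nat.mul_le_mul_right g (show j ≤ β by omega)
        nlinarith
      by_contra! hcon
      have h3 := Nat.mul_le_mul_right c hj
      nlinarith
  · push Not at hc
    have hq1 := Nat.div_mul_le_self K β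
    have hq2 : K < β * (K / β + 1) := Nat.lt_mul_div_succ K hβ
    have hqg : K / β ≤ g := Nat.div_le_of_le_mul hlow
    have hhq : h ≤ K / β := by
      rw [Nat.le_div_iff_mul_le hβ]
      by_contra! hcon
      nlinarith
    set q := K / β
    refine ⟨⟨q + K, β + 1, by omega, by omega, by nlinarith, ?_⟩, by omega, ?_⟩
    · rw [show q + K + 1 - (K + 1) = q by omega]
      nlinarith
    · intro j c h1 h2
      by_contra! hcon
      have hjq : j * (q + 1) ≤ q + (K + 1) := (Nat.mul_le_mul_left j (by omega)).trans h2
      have hj : j ≤ β := by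
        by_contra! hj
        have := Nat.mul_le_mul_right (q + 1) hj
        nlinarith
      have h3 := Nat.mul_le_mul_right g hj
      nlinarith

end Arithmetic

theorem corollary2 (n m : ℕ) :
    (1 ≤ m → m ≤ n / 2 →
      IsRamseyNumber (SimpleGraph.pathGraph n) (fanGraph m) (2 * n - 1)) ∧
    (n / 2 + 1 ≤ m → m ≤ n - 1 →
      IsRamseyNumber (SimpleGraph.pathGraph n) (fanGraph m) (2 * m + n - 2)) ∧
    (2 ≤ n → n ≤ m →
      IsRamseyNumber (SimpleGraph.pathGraph n) (fanGraph m) (tValue n (2 * m))) := by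
  refine ⟨fun hm hmn => ?_, fun hm hmn => ?_, fun hn hnm => ?_⟩
  · obtain ⟨H, h₁, h₂⟩ := exists_three_cliques_example (n := n) (m := m) (a := n - 1) (b := n - 1)
      (b' := 0) rfl (by omega) (by omega) (by omega) (by omega) (Or.inr rfl)
    exact isRamseyNumber_of_example (by omega)
      (pathGraph_or_fanGraph_isContained (by omega) (Or.inr (by omega))) H h₁ h₂
  · obtain ⟨H, h₁, h₂⟩ := exists_three_cliques_example (n := n) (m := m) (a := n - 1) (b := m - 1)
      (b' := m - 1) rfl (by omega) (by omega) (by omega) (by omega) (Or.inl (by omega))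
    exact isRamseyNumber_of_example (by omega)
      (pathGraph_or_fanGraph_isContained (by omega) (Or.inr (by omega))) H h₁ h₂
  · obtain ⟨⟨N, j, hN, hj, hup, hlow⟩, hhalf, hcomp⟩ := tValue_spec hn hnm
    obtain ⟨H, h₁, h₂⟩ := exists_residue_example (n := n) (m := m) (by omega) hj hup hlow
    exact isRamseyNumber_of_example hN
      (pathGraph_or_fanGraph_isContained hn (Or.inl ⟨hnm, hhalf, hcomp⟩)) H h₁ h₂
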